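/- Let $s\ge 0$, $T>0$ and let $q\in L^\infty(0,1)$ be real. Let $\mathcal L y=-y''+qy$ be the Sturm-Liouville operator in $L^2(0,1)$ with Dirichlet conditions $y(0)=y(1)=0$ (domain $H^2\cap H^1_0$), and assume that all its eigenvalues are positive. For $r\ge 0$, $\mathcal L^{r}$ is the operator that multiplies each eigenfunction of eigenvalue $\lambda$ by $\lambda^{r}$; $W^s_{\mathcal L}=\{f\in L^2(0,1):\mathcal L^{s/2}f\in L^2(0,1)\}$ with norm $\|f\|_{W^s_{\mathcal L}}=\|\mathcal L^{s/2}f\|_{L^2}$. A net $(f_\varepsilon)_{\varepsilon\in(0,1]}$ in a normed space $X$ is *$X$-moderate* if $\|f_\varepsilon\|_X\le C\varepsilon^{-N}$ for some $N\in\mathbb N_0$, $C>0$ and all $\varepsilon\in(0,1]$, and *$X$-negligible* if for every $k>0$ there is $C_k>0$ with $\|f_\varepsilon\|_X\le C_k\varepsilon^k$ for all $\varepsilon\in(0,1]$. A *regularisation* of a distribution on $(0,1)$ is a net of functions that converges to it in $\mathcal D'(0,1)$ as $\varepsilon\to0^+$ (for instance, by convolution with a mollifier). Let $a,b,u_0,u_1\in\mathcal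 D'(0,1)$ with $a,b$ non-negative (that is, regularised by non-negative nets). Then the very weak solution of $$\partial_t^2u+\mathcal L^su+a(x)u+b(x)u_t=0,\quad u(0,x)=u_0(x),\quad u_t(0,x)=u_1(x),\quad u(t,0)=u(t,1)=0,\qquad (t,x)\in[0,T]\times(0,1),$$ is unique in the following sense. Let $(a_\varepsilon),(\tilde a_\varepsilon)$ and $(b_\varepsilon),(\tilde b_\varepsilon)$ be non-negative $L^\infty$-moderate regularisations of $a$ and of $b$ such that $(a_\varepsilon-\tilde a_\varepsilon)$ and $(b_\varepsilon-\tilde b_\varepsilon)$ are $L^\infty$-negligible; let $(u_{0,\varepsilon}),(\tilde u_{0,\varepsilon})$ be $W^s_{\mathcal L}$-moderate regularisations of $u_0$ with $W^s_{\mathcal L}$-negligible difference, and $(u_{1,\varepsilon}),(\tilde u_{1,\varepsilon})$ be $L^2$-moderate regularisations of $u_1$ with $L^2$-negligible difference. Suppose that, for every $\varepsilon\in(0,1]$, $u_\varepsilon$ and $\tilde u_\varepsilon$ in $C([0,T];W^s_{\mathcal L})\cap C^1([0,T];L^2(0,1))$ solve the above problem with $(a,b,u_0,u_1)$ replaced by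 $(a_\varepsilon,b_\varepsilon,u_{0,\varepsilon},u_{1,\varepsilon})$ and by $(\tilde a_\varepsilon,\tilde b_\varepsilon,\tilde u_{0,\varepsilon},\tilde u_{1,\varepsilon})$ respectively, the equation being understood in the sense of distributions with respect to $\mathcal L$ (tested against elements of $\bigcap_m\mathrm{Dom}(\mathcal L^m)$). Then $(u_\varepsilon(t,\cdot)-\tilde u_\varepsilon(t,\cdot))_\varepsilon$ is $L^2$-negligible for all $t\in[0,T]$, with constants $C_k$ independent of $t$. The same conclusion holds for arbitrary nets with these moderateness, non-negativity and negligibility properties, whether or not they regularise given distributions. -/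

import Mathlib

open MeasureTheory Set Filter Topology
open scoped ENNReal Distributions

noncomputable section

namespace FracSL

/-- Lebesgue measure on the interval `(0,1)`. -/
abbrev μ01 : Measure ℝ := (volume : Measure ℝ).restrict (Ioo (0 : ℝ) 1)

/-- The complex Hilbert space `L²(0,1)`. -/
abbrev L2 : Type := Lp ℂ 2 μ01

/-- The space `L^∞(0,1)` of real functions. -/
abbrev Linf : Type := Lp ℝ ∞ μ01

/-- The interval `(0,1)` as an open set, on which distributions live. -/
def I01 : TopologicalSpace.Opens ℝ := ⟨Ioo (0 : ℝ) 1, isOpen_Ioo⟩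

/-! ### The Sturm-Liouville operator -/

/-- `SL q y g`: `y` lies in the domain `H²(0,1) ∩ H¹₀(0,1)` of the Dirichlet Sturm-Liouville operator
and `-y'' + q y = g`. The element `y` is represented by a function `Y` that vanishes at `0` and `1`
and is differentiable on `[0,1]`, and whose derivative `Z` is absolutely continuous with
`Z' = q Y - g` almost everywhere (that is, `Z` is an indefinite integral of `q Y - g`). -/
def SL (q : Linf) (y g : L2) : Prop :=
  ∃ Y Z : ℝ → ℂ, (⇑y =ᵐ[μ01] Y) ∧ Y 0 = 0 ∧ Y 1 = 0 ∧
    (∀ x ∈ Icc (0 : ℝ) 1, HasDerivWithinAt Y (Z x) (Icc 0 1) x) ∧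
    (∀ x ∈ Icc (0 : ℝ) 1, Z x = Z 0 + ∫ t in (0 : ℝ)..x, ((q t : ℂ) * Y t - g t))

/-- `φ` is an eigenfunction of the Dirichlet Sturm-Liouville operator with eigenvalue `l`. -/
def IsEigenpair (q : Linf) (l : ℝ) (φ : L2) : Prop :=
  φ ≠ 0 ∧ SL q φ ((l : ℂ) • φ)

/-- All eigenvalues of the operator are positive. -/
def PositiveSpectrum (q : Linf) : Prop :=
  ∀ (l : ℝ) (φ : L2), IsEigenpair q l φ → 0 < l

/-! ### Fractional powers, Sobolev spaces, test functions -/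

/-- `IsPow q r f g`: `f` lies in the domain of the fractional power of order `r` and its image is `g`.
The power acts on every eigenfunction of eigenvalue `l` as multiplication by `l ^ r`; in terms of
Fourier coefficients, `⟨φ, g⟩ = l ^ r ⟨φ, f⟩` for every eigenpair `(l, φ)`. -/
def IsPow (q : Linf) (r : ℝ) (f g : L2) : Prop :=
  ∀ (l : ℝ) (φ : L2), IsEigenpair q l φ →
    inner ℂ φ g = ((l ^ r : ℝ) : ℂ) * inner ℂ φ f

/-- Membership in the Sobolev space `W^s` of the operator: the power of order `s / 2` maps `f` into
`L²`. (For `s ≥ 0` and positive spectrum, `W^s` is a subspace of `L²`.) -/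
def MemW (q : Linf) (s : ℝ) (f : L2) : Prop :=
  ∃ g : L2, IsPow q (s / 2) f g

open Classical in
/-- The fractional power of order `r`, extended by `0` outside its domain. -/
def pow (q : Linf) (r : ℝ) (f : L2) : L2 :=
  if h : ∃ g : L2, IsPow q r f g then h.choose else 0

/-- The norm of `W^s`: the `L²` norm of the power of order `s / 2`. -/
def normW (q : Linf) (s : ℝ) (f : L2) : ℝ := ‖pow q (s / 2) f‖

/-- Test functions of the operator: the intersection of the domains of all its integer powers.
`ψ j` is the `j`-th iterate of the operator applied to `φ`. -/
def IsTest (q : Linf) (φ : L2) : Prop :=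
  ∃ ψ : ℕ → L2, ψ 0 = φ ∧ ∀ j : ℕ, SL q (ψ j) (ψ (j + 1))

/-! ### Solutions of the wave equation -/

/-- `u` is a solution, in the class `C([0,T]; W^s) ∩ C¹([0,T]; L²)`, of
`u_tt + 𝓛^s u + a u + b u_t = 0` on `[0,T] × (0,1)`, `u(0) = u₀`, `u_t(0) = u₁`, with the Dirichlet
boundary conditions. Here `v = u_t`; the power of order `s` and the second time derivative are taken
in the space of `𝓛`-distributions, that is, after pairing with an arbitrary test function `φ` of the
operator, whose `s`-th power is `χ`. The boundary conditions are carried by the operator: its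
eigenfunctions vanish at `0` and `1`, and `u(t)` belongs to `W^s`. -/
def IsSolution (q : Linf) (s T : ℝ) (a b : Linf) (u₀ u₁ : L2) (u : ℝ → L2) : Prop :=
  (∀ t ∈ Icc (0 : ℝ) T, MemW q s (u t)) ∧
  ContinuousOn (fun t => pow q (s / 2) (u t)) (Icc 0 T) ∧
  ∃ v : ℝ → L2,
    (∀ t ∈ Icc (0 : ℝ) T, HasDerivWithinAt u (v t) (Icc 0 T) t) ∧
    ContinuousOn v (Icc 0 T) ∧
    u 0 = u₀ ∧ v 0 = u₁ ∧
    ∀ φ χ : L2, IsTest q φ → IsPow q s φ χ → ∀ t ∈ Icc (0 : ℝ) T,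
      HasDerivWithinAt (fun τ => inner ℂ φ (v τ))
        (-inner ℂ χ (u t) - inner ℂ φ (((a • u t : L2)) + (b • v t : L2))) (Icc 0 T) t

/-! ### Nets, moderateness, negligibility, regularisation

A net `(f_ε)`, `ε ∈ (0,1]`, is a function of a real variable of which only the values on `(0,1]`
matter. -/

/-- The net is moderate with respect to the norm `nrm`. -/
def IsModerate {X : Type*} (nrm : X → ℝ) (f : ℝ → X) : Prop :=
  ∃ N : ℕ, ∃ C : ℝ, 0 < C ∧ ∀ ε ∈ Ioc (0 : ℝ) 1, nrm (f ε) ≤ C * ε ^ (-(N : ℝ))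

/-- The net is negligible with respect to the norm `nrm`. -/
def IsNegligible {X : Type*} (nrm : X → ℝ) (f : ℝ → X) : Prop :=
  ∀ k : ℝ, 0 < k → ∃ C : ℝ, 0 < C ∧ ∀ ε ∈ Ioc (0 : ℝ) 1, nrm (f ε) ≤ C * ε ^ k

/-- A non-negative `L^∞`-moderate net. -/
def IsCoeffNet (a : ℝ → Linf) : Prop :=
  (∀ ε ∈ Ioc (0 : ℝ) 1, 0 ≤ a ε) ∧ IsModerate norm a

/-- A `W^s`-moderate net. -/
def IsWModerate (q : Linf) (s : ℝ) (f : ℝ → L2) : Prop :=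
  (∀ ε ∈ Ioc (0 : ℝ) 1, MemW q s (f ε)) ∧ IsModerate (normW q s) f

/-- A `W^s`-negligible net. -/
def IsWNegligible (q : Linf) (s : ℝ) (f : ℝ → L2) : Prop :=
  (∀ ε ∈ Ioc (0 : ℝ) 1, MemW q s (f ε)) ∧ IsNegligible (normW q s) f

/-- The nets of `L^p` functions that regularise the distribution `D` on `(0,1)`: they converge to `D`
in the sense of distributions as `ε → 0+`. This includes the nets obtained by convolution with a
Friedrichs mollifier. -/
def Regularisations {F : Type*} [NormedAddCommGroup F] [NormedSpace ℝ F] (p : ℝ≥0∞)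
    (D : 𝓓'(I01, F)) : Set (ℝ → Lp F p μ01) :=
  {f | ∀ φ : 𝓓(I01, ℝ),
    Tendsto (fun ε => ∫ x, φ x • f ε x ∂μ01) (𝓝[>] 0) (𝓝 (D φ))}

/-! ### Uniqueness of very weak solutions -/

/-- Uniqueness of the solution net up to negligible nets, when the nets of coefficients and of data
are allowed to range over the classes `A`, `B`, `U`, `V`: negligible changes of the nets change the
net of solutions by an `L²`-negligible net, with constants uniform in `t ∈ [0,T]`. -/
def NetUniqueness (q : Linf) (s T : ℝ) (A B : Set (ℝ → Linf)) (U V : Set (ℝ → L2)) : Prop :=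
  ∀ a a' : ℝ → Linf, a ∈ A → a' ∈ A → IsCoeffNet a → IsCoeffNet a' →
    IsNegligible norm (fun ε => a ε - a' ε) →
  ∀ b b' : ℝ → Linf, b ∈ B → b' ∈ B → IsCoeffNet b → IsCoeffNet b' →
    IsNegligible norm (fun ε => b ε - b' ε) →
  ∀ u₀ u₀' : ℝ → L2, u₀ ∈ U → u₀' ∈ U → IsWModerate q s u₀ → IsWModerate q s u₀' →
    IsWNegligible q s (fun ε => u₀ ε - u₀' ε) →
  ∀ u₁ u₁' : ℝ → L2, u₁ ∈ V → u₁' ∈ V → IsModerate norm u₁ → IsModerate norm u₁' →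
    IsNegligible norm (fun ε => u₁ ε - u₁' ε) →
  ∀ u u' : ℝ → ℝ → L2,
    (∀ ε ∈ Ioc (0 : ℝ) 1, IsSolution q s T (a ε) (b ε) (u₀ ε) (u₁ ε) (u ε)) →
    (∀ ε ∈ Ioc (0 : ℝ) 1, IsSolution q s T (a' ε) (b' ε) (u₀' ε) (u₁' ε) (u' ε)) →
  ∀ k : ℝ, 0 < k → ∃ C : ℝ, 0 < C ∧ ∀ ε ∈ Ioc (0 : ℝ) 1, ∀ t ∈ Icc (0 : ℝ) T,
    ‖u ε t - u' ε t‖ ≤ C * ε ^ k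

/-- The initial/boundary problem with distributional coefficients `a`, `b` and data `u₀`, `u₁` has a
unique very weak solution: the nets range over the regularisations of the given distributions. -/
def HasUniqueVeryWeakSolution (q : Linf) (s T : ℝ) (a b : 𝓓'(I01, ℝ)) (u₀ u₁ : 𝓓'(I01, ℂ)) :
    Prop :=
  NetUniqueness q s T (Regularisations ∞ a) (Regularisations ∞ b)
    (Regularisations 2 u₀) (Regularisations 2 u₁)

end FracSL

end

/-!
Expand in the Dirichlet eigenfunctions: the inverse of the Sturm-Liouville operator is compact and
symmetric, so they form a Hilbert basis, and positivity of the eigenvalues bounds them below by some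
`δ > 0`. The wave equation decouples into oscillators with a forcing. Their summed energies,
together with the potential energy `⟪a u, u⟫`, grow at most like `exp t`, whatever the size of the
coefficients: the damping `b ≥ 0` only dissipates. Hence a solution is bounded linearly in its data,
with a constant affine in `‖a‖`.

The difference of two solutions solves the second equation with the forcing
`-(a - a') u - (b - b') u_t`, which is negligible because `u` and `u_t` are moderate; applying the
energy estimate to the difference multiplies negligible quantities by moderate ones.
-/

noncomputable section

open scoped InnerProductSpace

namespace FracSL

/-! ### Compact operators on Hilbert spaces -/

section Hilbert

universe u v w

variable {𝕜 : Type u} {H : Type w} [RCLike 𝕜] [NormedAddCommGroup H] [InnerProductSpace 𝕜 H]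

lemma countable_of_orthonormal [TopologicalSpace.SeparableSpace H] {ι : Type*} {v : ι → H}
    (hv : Orthonormal 𝕜 v) : Countable ι := by
  have hdist : ∀ i j, i ≠ j → 1 / 2 + 1 / 2 ≤ dist (v i) (v j) := fun i j hij => by
    have hsq : ‖v i - v j‖ ^ 2 = 2 := by
      rw [@norm_sub_sq 𝕜, hv.1, hv.1, hv.2 hij]; norm_num
    rw [dist_eq_norm]
    nlinarith [norm_nonneg (v i - v j)]
  refine countable_univ_iff.1 (PairwiseDisjoint.countable_of_isOpen
    (s := fun i => Metric.ball (v i) (1 / 2)) ?_ (fun _ _ => Metric.isOpen_ball)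
    fun i _ => ⟨v i, Metric.mem_ball_self (by norm_num)⟩)
  exact fun i _ j _ hij => Metric.ball_disjoint_ball (hdist i j hij)

lemma hasSum_sq_norm_inner {ι : Type*} (e : HilbertBasis ι 𝕜 H) (f : H) :
    HasSum (fun i => ‖⟪e i, f⟫_𝕜‖ ^ 2) (‖f‖ ^ 2) := by
  have h := (e.hasSum_inner_mul_inner f f).mapL RCLike.reCLM
  simp only [RCLike.reCLM_apply, inner_self_eq_norm_sq] at h
  refine h.congr_fun fun i => ?_
  rw [inner_mul_symm_re_eq_norm, norm_mul, norm_inner_symm, sq]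

variable [CompleteSpace H]

lemma exists_hilbertBasis_of_orthogonalFamily {κ : Type v} {V : κ → Submodule 𝕜 H}
    (hclosed : ∀ k, IsClosed (V k : Set H))
    (hV : OrthogonalFamily 𝕜 (fun k => V k) fun k => (V k).subtypeₗᵢ) (htop : (⨆ k, V k)ᗮ = ⊥) :
    ∃ (ι : Type (max v w)) (b : HilbertBasis ι 𝕜 H), ∀ i, ∃ k, b i ∈ V k := by
  have : ∀ k, CompleteSpace (V k) := fun k => (hclosed k).completeSpace_coe
  choose S b _ using fun k => exists_hilbertBasis 𝕜 (V k)
  have hb : Orthonormal 𝕜 fun i : Σ k, S k => (b i.1 i.2 : H) :=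
    hV.orthonormal_sigma_orthonormal fun k => (b k).orthonormal
  have horth : (Submodule.span 𝕜 (range fun i : Σ k, S k => (b i.1 i.2 : H)))ᗮ = ⊥ := by
    rw [eq_bot_iff, ← htop, ← Submodule.iInf_orthogonal]
    refine fun x hx => (Submodule.mem_iInf _).2 fun k => ?_
    rw [Submodule.mem_orthogonal'] at hx ⊢
    have hzero : innerSL 𝕜 x ∘L (V k).subtypeL = 0 :=
      ContinuousLinearMap.ext_on
        (Submodule.dense_iff_topologicalClosure_eq_top.2 (b k).dense_span)
        (eqOn_range.2 (funext fun i => hx _ (Submodule.subset_span ⟨⟨k, i⟩, rfl⟩)))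
    exact fun y hy => DFunLike.congr_fun hzero ⟨y, hy⟩
  refine ⟨_, HilbertBasis.mkOfOrthogonalEqBot hb horth, fun i => ⟨i.1, ?_⟩⟩
  rw [HilbertBasis.coe_mkOfOrthogonalEqBot]
  exact (b i.1 i.2).2

lemma exists_hilbertBasis_eigenvectors {K : H →L[𝕜] H} (hK : IsCompactOperator K)
    (hsymm : (K : H →ₗ[𝕜] H).IsSymmetric) :
    ∃ (ι : Type (max u w)) (b : HilbertBasis ι 𝕜 H) (m : ι → ℝ),
      ∀ i, K (b i) = (m i : 𝕜) • b i := by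
  have hclosed : ∀ z, IsClosed (Module.End.eigenspace (K : Module.End 𝕜 H) z : Set H) := fun z => by
    have : (Module.End.eigenspace (K : Module.End 𝕜 H) z : Set H) = {x | K x = z • x} :=
      Set.ext fun _ => Module.End.mem_eigenspace_iff
    exact this ▸ isClosed_eq K.continuous (continuous_const_smul z)
  obtain ⟨ι, b, hb⟩ := exists_hilbertBasis_of_orthogonalFamily hclosed
    hsymm.orthogonalFamily_eigenspaces
    (ContinuousLinearMap.orthogonalComplement_iSup_eigenspaces_eq_bot hK hsymm)
  choose m hm using hb
  refine ⟨ι, b, fun i => RCLike.re (m i), fun i => ?_⟩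
  have heig : Module.End.HasEigenvalue (K : Module.End 𝕜 H) (m i) :=
    Module.End.hasEigenvalue_of_hasEigenvector ⟨hm i, b.orthonormal.ne_zero i⟩
  rw [RCLike.conj_eq_iff_re.1 (hsymm.conj_eigenvalue_eq_self heig)]
  exact Module.End.mem_eigenspace_iff.1 (hm i)

end Hilbert

/-- The Fredholm alternative: `1 + GQ` is invertible as soon as it is injective. -/
lemma exists_isCompactOperator_forall_eq_iff {𝕜 X : Type*} [RCLike 𝕜] [NormedAddCommGroup X]
    [NormedSpace 𝕜 X] [CompleteSpace X] {G : X →L[𝕜] X} (hG : IsCompactOperator G) (Q : X →L[𝕜] X)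
    (hinj : ∀ y, y = G (-Q y) → y = 0) :
    ∃ K : X →L[𝕜] X, IsCompactOperator K ∧ ∀ y g, y = G (g - Q y) ↔ y = K g := by
  have heig : ¬ Module.End.HasEigenvalue ((G ∘L Q : X →L[𝕜] X) : Module.End 𝕜 X) (-1) := fun h => by
    obtain ⟨y, hy, hy0⟩ := h.exists_hasEigenvector
    have : G (Q y) = -y := by simpa using Module.End.mem_eigenspace_iff.1 hy
    exact hy0 (hinj y (by rw [map_neg, this, neg_neg]))
  obtain ⟨U, hU⟩ := ((hG.comp_clm Q).hasEigenvalue_or_mem_resolventSet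
    (neg_ne_zero.2 one_ne_zero)).resolve_left heig
  have hU_apply : ∀ y, U.1 y = -(y + G (Q y)) := fun y => by rw [hU]; simp; abel
  have hleft : ∀ y, U⁻¹.1 (U.1 y) = y := fun y => DFunLike.congr_fun U.inv_mul y
  have hright : ∀ y, U.1 (U⁻¹.1 y) = y := fun y => DFunLike.congr_fun U.mul_inv y
  refine ⟨-(U⁻¹.1 ∘L G), (hG.clm_comp U⁻¹.1).neg, fun y g => ?_⟩
  rw [neg_apply, ContinuousLinearMap.comp_apply]
  calc y = G (g - Q y) ↔ U.1 y = -G g := by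
        rw [hU_apply, neg_inj, map_sub, eq_sub_iff_add_eq]
    _ ↔ y = -U⁻¹.1 (G g) := by
        rw [← map_neg U⁻¹.1]
        exact ⟨fun h => by rw [← h, hleft], fun h => by rw [h, hright]⟩

/-! ### Energy of abstract wave equations -/

lemma hasDerivWithinAt_integral_Icc {E : Type*} [NormedAddCommGroup E] [NormedSpace ℝ E]
    [CompleteSpace E] {a b t : ℝ} {g : ℝ → E} (hg : ContinuousOn g (Icc a b)) (ht : t ∈ Icc a b) :
    HasDerivWithinAt (fun x => ∫ τ in a..x, g τ) (g t) (Icc a b) t := by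
  have : Fact (t ∈ Icc a b) := ⟨ht⟩
  refine intervalIntegral.integral_hasDerivWithinAt_right ?_
    (hg.stronglyMeasurableAtFilter_nhdsWithin measurableSet_Icc t) (hg t ht)
  exact (hg.mono (uIcc_subset_Icc (left_mem_Icc.2 (ht.1.trans ht.2)) ht)).intervalIntegrable

section Energy

variable {H : Type*} [NormedAddCommGroup H] [InnerProductSpace ℂ H] {ι : Type*}

lemma abs_sum_two_mul_re_inner_le (e : HilbertBasis ι ℂ H) (S : Finset ι) (f g : H) :
    |∑ i ∈ S, 2 * (⟪f, e i⟫_ℂ * ⟪e i, g⟫_ℂ).re| ≤ ‖f‖ ^ 2 + ‖g‖ ^ 2 := by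
  have hterm : ∀ i ∈ S, |2 * (⟪f, e i⟫_ℂ * ⟪e i, g⟫_ℂ).re| ≤
      ‖⟪e i, f⟫_ℂ‖ ^ 2 + ‖⟪e i, g⟫_ℂ‖ ^ 2 := fun i _ => by
    have h := Complex.abs_re_le_norm (⟪f, e i⟫_ℂ * ⟪e i, g⟫_ℂ)
    rw [norm_mul, norm_inner_symm] at h
    rw [abs_mul, abs_two]
    nlinarith [sq_nonneg (‖⟪e i, f⟫_ℂ‖ - ‖⟪e i, g⟫_ℂ‖)]
  calc _ ≤ ∑ i ∈ S, (‖⟪e i, f⟫_ℂ‖ ^ 2 + ‖⟪e i, g⟫_ℂ‖ ^ 2) :=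
        (Finset.abs_sum_le_sum_abs _ _).trans (Finset.sum_le_sum hterm)
    _ ≤ ‖f‖ ^ 2 + ‖g‖ ^ 2 := by
        rw [Finset.sum_add_distrib]
        exact add_le_add (e.orthonormal.sum_inner_products_le f)
          (e.orthonormal.sum_inner_products_le g)

lemma continuousOn_sum_two_mul_re_inner {X : Type*} [TopologicalSpace X] {e : ι → H} {s : Set X}
    {v h : X → H} (hv : ContinuousOn v s) (hh : ContinuousOn h s) (S : Finset ι) :
    ContinuousOn (fun τ => ∑ i ∈ S, 2 * (⟪v τ, e i⟫_ℂ * ⟪e i, h τ⟫_ℂ).re) s :=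
  continuousOn_finsetSum _ fun _ _ => continuousOn_const.mul
    (Complex.continuous_re.comp_continuousOn
      ((hv.inner continuousOn_const).mul (continuousOn_const.inner hh)))

lemma tendsto_integral_sum_two_mul_re_inner [Countable ι] (e : HilbertBasis ι ℂ H) {a b : ℝ}
    {v h : ℝ → H} (hv : ContinuousOn v (uIcc a b)) (hh : ContinuousOn h (uIcc a b)) :
    Tendsto (fun S : Finset ι => ∫ τ in a..b, ∑ i ∈ S, 2 * (⟪v τ, e i⟫_ℂ * ⟪e i, h τ⟫_ℂ).re)
      atTop (𝓝 (∫ τ in a..b, 2 * (⟪v τ, h τ⟫_ℂ).re)) := by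
  refine intervalIntegral.tendsto_integral_filter_of_dominated_convergence
    (fun τ => ‖v τ‖ ^ 2 + ‖h τ‖ ^ 2) (Eventually.of_forall fun S => ?_)
    (Eventually.of_forall fun S => ae_of_all _ fun τ _ =>
      abs_sum_two_mul_re_inner_le e S (v τ) (h τ))
    ((hv.norm.pow 2).add (hh.norm.pow 2)).intervalIntegrable
    (ae_of_all _ fun τ _ => ?_)
  · exact ((continuousOn_sum_two_mul_re_inner hv hh S).mono uIoc_subset_uIcc).aestronglyMeasurable
      measurableSet_uIoc
  · exact ((e.hasSum_inner_mul_inner (v τ) (h τ)).mapL Complex.reCLM).mul_left 2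

lemma sq_add_reApplyInnerSelf_le (a : H →L[ℂ] H) (f g h : H) {R : ℝ} (hR : 0 ≤ R) :
    ‖f‖ ^ 2 + ‖g‖ ^ 2 + a.reApplyInnerSelf h + R ^ 2 ≤
      ((1 + ‖a‖) * (‖f‖ + ‖g‖ + ‖h‖ + R)) ^ 2 := by
  have hpotential : a.reApplyInnerSelf h ≤ ‖a‖ * ‖h‖ ^ 2 := by
    calc a.reApplyInnerSelf h ≤ ‖a h‖ * ‖h‖ := re_inner_le_norm (𝕜 := ℂ) _ _
      _ ≤ ‖a‖ * ‖h‖ ^ 2 := by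
        rw [sq, ← mul_assoc]; gcongr; exact a.le_opNorm h
  have hsquares : ‖f‖ ^ 2 + ‖g‖ ^ 2 + ‖h‖ ^ 2 + R ^ 2 ≤ (‖f‖ + ‖g‖ + ‖h‖ + R) ^ 2 := by
    rw [← sub_nonneg]
    ring_nf
    positivity
  have hone : 1 ≤ 1 + ‖a‖ := le_add_of_nonneg_right (norm_nonneg a)
  calc _ ≤ ‖f‖ ^ 2 + ‖g‖ ^ 2 + ‖a‖ * ‖h‖ ^ 2 + R ^ 2 := by gcongr
    _ ≤ (1 + ‖a‖) * (‖f‖ ^ 2 + ‖g‖ ^ 2 + ‖h‖ ^ 2 + R ^ 2) := by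
        rw [← sub_nonneg]
        ring_nf
        positivity
    _ ≤ (1 + ‖a‖) ^ 2 * (‖f‖ + ‖g‖ + ‖h‖ + R) ^ 2 := by
        gcongr
        exact le_self_pow₀ hone two_ne_zero
    _ = _ := (mul_pow _ _ 2).symm

lemma norm_le_inv_mul_norm_of_inner_eq {e : HilbertBasis ι ℂ H} {μ : ι → ℝ} {δ : ℝ} (hδ : 0 < δ)
    (hμ : ∀ i, δ ≤ μ i) {f g : H} (hfg : ∀ i, ⟪e i, g⟫_ℂ = μ i * ⟪e i, f⟫_ℂ) :
    ‖f‖ ≤ δ⁻¹ * ‖g‖ := by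
  rw [le_inv_mul_iff₀ hδ]
  refine le_of_sq_le_sq ?_ (norm_nonneg g)
  rw [mul_pow]
  refine hasSum_le (fun i => ?_) ((hasSum_sq_norm_inner e f).mul_left _) (hasSum_sq_norm_inner e g)
  rw [hfg, norm_mul, mul_pow, Complex.norm_real, Real.norm_of_nonneg (hδ.le.trans (hμ i))]
  gcongr
  exact hμ i

/-- `w` solves `w'' + Λ² w = h` on `[0, T]`, with velocity `v = w'` and `A = Λ w`, where `Λ` is the
self-adjoint operator that multiplies the vector `e i` of a Hilbert basis by `μ i`. The operator may
be unbounded; it and the second derivative enter only through the coordinates in the basis. -/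
structure IsDiagonalWave (e : HilbertBasis ι ℂ H) (μ : ι → ℝ) (T : ℝ) (h w v A : ℝ → H) :
    Prop where
  hasDerivWithinAt : ∀ t ∈ Icc 0 T, HasDerivWithinAt w (v t) (Icc 0 T) t
  continuousOn_velocity : ContinuousOn v (Icc 0 T)
  inner_eq : ∀ t ∈ Icc 0 T, ∀ i, ⟪e i, A t⟫_ℂ = μ i * ⟪e i, w t⟫_ℂ
  hasDerivWithinAt_inner : ∀ t ∈ Icc 0 T, ∀ i, HasDerivWithinAt (fun τ => ⟪e i, v τ⟫_ℂ)
    (-(μ i ^ 2 * ⟪e i, w t⟫_ℂ) + ⟪e i, h t⟫_ℂ) (Icc 0 T) t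

namespace IsDiagonalWave

variable {e : HilbertBasis ι ℂ H} {μ : ι → ℝ} {T t : ℝ} {h h' w w' v v' A A' : ℝ → H}

lemma sub (hw : IsDiagonalWave e μ T h w v A) (hw' : IsDiagonalWave e μ T h' w' v' A') :
    IsDiagonalWave e μ T (h - h') (w - w') (v - v') (A - A') where
  hasDerivWithinAt t ht := (hw.hasDerivWithinAt t ht).sub (hw'.hasDerivWithinAt t ht)
  continuousOn_velocity := hw.continuousOn_velocity.sub hw'.continuousOn_velocity
  inner_eq t ht i := by
    simp only [Pi.sub_apply, inner_sub_right, hw.inner_eq t ht i, hw'.inner_eq t ht i, mul_sub]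
  hasDerivWithinAt_inner t ht i := by
    simp only [Pi.sub_apply, inner_sub_right]
    refine ((hw.hasDerivWithinAt_inner t ht i).sub
      (hw'.hasDerivWithinAt_inner t ht i)).congr_deriv ?_
    ring

lemma congr_forcing (hw : IsDiagonalWave e μ T h w v A) (hh : EqOn h h' (Icc 0 T)) :
    IsDiagonalWave e μ T h' w v A :=
  { hw with
    hasDerivWithinAt_inner := fun t ht i => hh ht ▸ hw.hasDerivWithinAt_inner t ht i }

lemma continuousOn (hw : IsDiagonalWave e μ T h w v A) : ContinuousOn w (Icc 0 T) :=
  fun t ht => (hw.hasDerivWithinAt t ht).continuousWithinAt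

lemma hasDerivWithinAt_energy_mode (hw : IsDiagonalWave e μ T h w v A) (ht : t ∈ Icc 0 T) (i : ι) :
    HasDerivWithinAt (fun τ => ‖⟪e i, v τ⟫_ℂ‖ ^ 2 + ‖⟪e i, A τ⟫_ℂ‖ ^ 2)
      (2 * (⟪v t, e i⟫_ℂ * ⟪e i, h t⟫_ℂ).re) (Icc 0 T) t := by
  have hcoord : HasDerivWithinAt (fun τ => ⟪e i, w τ⟫_ℂ) ⟪e i, v t⟫_ℂ (Icc 0 T) t :=
    ((innerSL ℂ (e i)).restrictScalars ℝ).hasFDerivAt.comp_hasDerivWithinAt t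
      (hw.hasDerivWithinAt t ht)
  have hpotential : ∀ τ ∈ Icc 0 T, ‖⟪e i, A τ⟫_ℂ‖ ^ 2 = μ i ^ 2 * ‖⟪e i, w τ⟫_ℂ‖ ^ 2 :=
    fun τ hτ => by
      rw [hw.inner_eq τ hτ i, norm_mul, mul_pow, Complex.norm_real, Real.norm_eq_abs, sq_abs]
  refine ((hw.hasDerivWithinAt_inner t ht i).norm_sq.add
    ((hcoord.norm_sq.const_mul (μ i ^ 2)).congr hpotential (hpotential t ht))).congr_deriv ?_
  rw [← inner_conj_symm (v t) (e i), ← Complex.ofReal_pow]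
  simp only [Complex.inner, Complex.mul_re, Complex.add_re, Complex.neg_re, Complex.mul_im,
    Complex.add_im, Complex.neg_im, Complex.conj_re, Complex.conj_im, Complex.ofReal_re,
    Complex.ofReal_im]
  ring

lemma sum_energy_mode_sub (hw : IsDiagonalWave e μ T h w v A) (hh : ContinuousOn h (Icc 0 T))
    (ht : t ∈ Icc 0 T) (S : Finset ι) :
    ∑ i ∈ S, (‖⟪e i, v t⟫_ℂ‖ ^ 2 + ‖⟪e i, A t⟫_ℂ‖ ^ 2) -
        ∑ i ∈ S, (‖⟪e i, v 0⟫_ℂ‖ ^ 2 + ‖⟪e i, A 0⟫_ℂ‖ ^ 2) =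
      ∫ τ in (0 : ℝ)..t, ∑ i ∈ S, 2 * (⟪v τ, e i⟫_ℂ * ⟪e i, h τ⟫_ℂ).re := by
  have hsub : Icc 0 t ⊆ Icc 0 T := Icc_subset_Icc_right ht.2
  have hderiv : ∀ τ ∈ Icc 0 T, HasDerivWithinAt
      (fun τ => ∑ i ∈ S, (‖⟪e i, v τ⟫_ℂ‖ ^ 2 + ‖⟪e i, A τ⟫_ℂ‖ ^ 2))
      (∑ i ∈ S, 2 * (⟪v τ, e i⟫_ℂ * ⟪e i, h τ⟫_ℂ).re) (Icc 0 T) τ :=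
    fun τ hτ => HasDerivWithinAt.fun_sum fun i _ => hw.hasDerivWithinAt_energy_mode hτ i
  have hcont := (continuousOn_sum_two_mul_re_inner (e := e) hw.continuousOn_velocity hh S).mono hsub
  refine (intervalIntegral.integral_eq_sub_of_hasDerivAt_of_le ht.1
    (fun τ hτ => ((hderiv τ (hsub hτ)).mono hsub).continuousWithinAt)
    (fun τ hτ => (hderiv τ (hsub (Ioo_subset_Icc_self hτ))).hasDerivAt
      (Icc_mem_nhds hτ.1 (hτ.2.trans_le ht.2))) ?_).symm
  exact ContinuousOn.intervalIntegrable (by rwa [uIcc_of_le ht.1])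

lemma energy_eq [Countable ι] (hw : IsDiagonalWave e μ T h w v A) (hh : ContinuousOn h (Icc 0 T))
    (ht : t ∈ Icc 0 T) :
    ‖v t‖ ^ 2 + ‖A t‖ ^ 2 =
      ‖v 0‖ ^ 2 + ‖A 0‖ ^ 2 + ∫ τ in (0 : ℝ)..t, 2 * (⟪v τ, h τ⟫_ℂ).re := by
  have hsub : uIcc 0 t ⊆ Icc 0 T := by
    rw [uIcc_of_le ht.1]; exact Icc_subset_Icc_right ht.2
  have hsum : ∀ τ, HasSum (fun i => ‖⟪e i, v τ⟫_ℂ‖ ^ 2 + ‖⟪e i, A τ⟫_ℂ‖ ^ 2)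
      (‖v τ‖ ^ 2 + ‖A τ‖ ^ 2) :=
    fun τ => (hasSum_sq_norm_inner e (v τ)).add (hasSum_sq_norm_inner e (A τ))
  rw [← sub_eq_iff_eq_add']
  refine ((hsum t).sub (hsum 0)).unique ?_
  simpa only [HasSum, SummationFilter.unconditional_filter, Finset.sum_sub_distrib,
    hw.sum_energy_mode_sub hh ht] using tendsto_integral_sum_two_mul_re_inner e
      (hw.continuousOn_velocity.mono hsub) (hh.mono hsub)

lemma hasDerivWithinAt_energy [Countable ι] (hw : IsDiagonalWave e μ T h w v A)
    (hh : ContinuousOn h (Icc 0 T)) (ht : t ∈ Icc 0 T) :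
    HasDerivWithinAt (fun τ => ‖v τ‖ ^ 2 + ‖A τ‖ ^ 2) (2 * (⟪v t, h t⟫_ℂ).re) (Icc 0 T) t := by
  have hpower : ContinuousOn (fun τ => 2 * (⟪v τ, h τ⟫_ℂ).re) (Icc 0 T) :=
    continuousOn_const.mul
      (Complex.continuous_re.comp_continuousOn (hw.continuousOn_velocity.inner hh))
  exact ((hasDerivWithinAt_integral_Icc hpower ht).const_add (‖v 0‖ ^ 2 + ‖A 0‖ ^ 2)).congr
    (fun τ hτ => hw.energy_eq hh hτ) (hw.energy_eq hh ht)

variable {a b : H →L[ℂ] H} {F : ℝ → H} {R : ℝ}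

lemma hasDerivWithinAt_damped_energy [Countable ι]
    (hw : IsDiagonalWave e μ T (fun t => F t - a (w t) - b (v t)) w v A)
    (ha : (a : H →ₗ[ℂ] H).IsSymmetric) (hF : ContinuousOn F (Icc 0 T)) (ht : t ∈ Icc 0 T) :
    HasDerivWithinAt (fun τ => ‖v τ‖ ^ 2 + ‖A τ‖ ^ 2 + a.reApplyInnerSelf (w τ))
      (2 * (⟪v t, F t⟫_ℂ).re - 2 * b.reApplyInnerSelf (v t)) (Icc 0 T) t := by
  have hforcing : ContinuousOn (fun t => F t - a (w t) - b (v t)) (Icc 0 T) :=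
    (hF.sub (a.continuous.comp_continuousOn hw.continuousOn)).sub
      (b.continuous.comp_continuousOn hw.continuousOn_velocity)
  have haw : HasDerivWithinAt (fun τ => a (w τ)) (a (v t)) (Icc 0 T) t :=
    (a.restrictScalars ℝ).hasFDerivAt.comp_hasDerivWithinAt t (hw.hasDerivWithinAt t ht)
  have hpotential : HasDerivWithinAt (fun τ => a.reApplyInnerSelf (w τ))
      (2 * (⟪v t, a (w t)⟫_ℂ).re) (Icc 0 T) t := by
    refine (Complex.reCLM.hasFDerivAt.comp_hasDerivWithinAt t
      (haw.inner ℂ (hw.hasDerivWithinAt t ht))).congr_deriv ?_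
    have hsymm : ⟪a (v t), w t⟫_ℂ = ⟪v t, a (w t)⟫_ℂ := ha _ _
    have hconj : (⟪a (w t), v t⟫_ℂ).re = (⟪v t, a (w t)⟫_ℂ).re :=
      inner_re_symm (𝕜 := ℂ) _ _
    rw [Complex.reCLM_apply, Complex.add_re, hsymm, hconj, two_mul]
  refine ((hw.hasDerivWithinAt_energy hforcing ht).add hpotential).congr_deriv ?_
  have hdamping : (⟪v t, b (v t)⟫_ℂ).re = b.reApplyInnerSelf (v t) :=
    inner_re_symm (𝕜 := ℂ) _ _
  rw [inner_sub_right, inner_sub_right, Complex.sub_re, Complex.sub_re, hdamping]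
  ring

/-- The energy contains the potential `⟪a w, w⟫`, which keeps the size of `a` out of the
exponent. -/
lemma damped_energy_le [Countable ι]
    (hw : IsDiagonalWave e μ T (fun t => F t - a (w t) - b (v t)) w v A) (ha : a.IsPositive)
    (hb : ∀ f, 0 ≤ b.reApplyInnerSelf f) (hF : ContinuousOn F (Icc 0 T))
    (hR : ∀ t ∈ Icc 0 T, ‖F t‖ ≤ R) (ht : t ∈ Icc 0 T) :
    ‖v t‖ ^ 2 + ‖A t‖ ^ 2 + a.reApplyInnerSelf (w t) ≤
      Real.exp t * (‖v 0‖ ^ 2 + ‖A 0‖ ^ 2 + a.reApplyInnerSelf (w 0) + R ^ 2) := by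
  have hderiv := fun τ (hτ : τ ∈ Icc 0 T) =>
    hw.hasDerivWithinAt_damped_energy ha.isSymmetric hF hτ
  have hbound : ∀ τ ∈ Ico 0 T, 2 * (⟪v τ, F τ⟫_ℂ).re - 2 * b.reApplyInnerSelf (v τ) ≤
      1 * (‖v τ‖ ^ 2 + ‖A τ‖ ^ 2 + a.reApplyInnerSelf (w τ)) + R ^ 2 := fun τ hτ => by
    have hre : (⟪v τ, F τ⟫_ℂ).re ≤ ‖v τ‖ * ‖F τ‖ :=
      re_inner_le_norm (𝕜 := ℂ) _ _
    have hFR : ‖F τ‖ ^ 2 ≤ R ^ 2 := by gcongr; exact hR τ (Ico_subset_Icc_self hτ)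
    nlinarith [sq_nonneg (‖v τ‖ - ‖F τ‖), sq_nonneg ‖A τ‖, hb (v τ), ha.2 (w τ)]
  have hgronwall := le_gronwallBound_of_liminf_deriv_right_le
    (fun τ hτ => (hderiv τ hτ).continuousWithinAt)
    (fun τ hτ r hr => ((hderiv τ (Ico_subset_Icc_self hτ)).mono_of_mem_nhdsWithin
      (Icc_mem_nhdsGE_of_mem hτ)).liminf_right_slope_le hr) le_rfl hbound t ht
  simp only [gronwallBound_of_K_ne_0 one_ne_zero, sub_zero, one_mul, div_one] at hgronwall
  nlinarith [sq_nonneg R]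

lemma norm_le_and_norm_le [Countable ι]
    (hw : IsDiagonalWave e μ T (fun t => F t - a (w t) - b (v t)) w v A) (ha : a.IsPositive)
    (hb : ∀ f, 0 ≤ b.reApplyInnerSelf f) (hF : ContinuousOn F (Icc 0 T))
    (hR : ∀ t ∈ Icc 0 T, ‖F t‖ ≤ R) (ht : t ∈ Icc 0 T) :
    ‖v t‖ ≤ Real.exp T * ((1 + ‖a‖) * (‖v 0‖ + ‖A 0‖ + ‖w 0‖ + R)) ∧
      ‖A t‖ ≤ Real.exp T * ((1 + ‖a‖) * (‖v 0‖ + ‖A 0‖ + ‖w 0‖ + R)) := by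
  have hR0 : 0 ≤ R := (norm_nonneg _).trans (hR t ht)
  have hexp : Real.exp t ≤ Real.exp T ^ 2 := by
    rw [← Real.exp_nat_mul, Real.exp_le_exp]; push_cast; linarith [ht.1, ht.2]
  have hle : ‖v t‖ ^ 2 + ‖A t‖ ^ 2 ≤
      (Real.exp T * ((1 + ‖a‖) * (‖v 0‖ + ‖A 0‖ + ‖w 0‖ + R))) ^ 2 := by
    calc ‖v t‖ ^ 2 + ‖A t‖ ^ 2 ≤ ‖v t‖ ^ 2 + ‖A t‖ ^ 2 + a.reApplyInnerSelf (w t) :=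
          le_add_of_nonneg_right (ha.2 (w t))
      _ ≤ Real.exp t * (‖v 0‖ ^ 2 + ‖A 0‖ ^ 2 + a.reApplyInnerSelf (w 0) + R ^ 2) :=
          hw.damped_energy_le ha hb hF hR ht
      _ ≤ Real.exp T ^ 2 * ((1 + ‖a‖) * (‖v 0‖ + ‖A 0‖ + ‖w 0‖ + R)) ^ 2 := by
          refine mul_le_mul hexp (sq_add_reApplyInnerSelf_le a _ _ _ hR0) ?_ (by positivity)
          have := ha.2 (w 0)
          positivity
      _ = _ := (mul_pow _ _ 2).symm
  exact ⟨abs_le_of_sq_le_sq' (by linarith [sq_nonneg ‖A t‖]) (by positivity) |>.2,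
    abs_le_of_sq_le_sq' (by linarith [sq_nonneg ‖v t‖]) (by positivity) |>.2⟩

variable {a' b' : H →L[ℂ] H} {δ : ℝ}

lemma norm_le (hw : IsDiagonalWave e μ T h w v A) (hδ : 0 < δ) (hμ : ∀ i, δ ≤ μ i)
    (ht : t ∈ Icc 0 T) : ‖w t‖ ≤ δ⁻¹ * ‖A t‖ :=
  norm_le_inv_mul_norm_of_inner_eq hδ hμ (hw.inner_eq t ht)

lemma sub_of_coefficients
    (hw : IsDiagonalWave e μ T (fun t => -(a (w t) + b (v t))) w v A)
    (hw' : IsDiagonalWave e μ T (fun t => -(a' (w' t) + b' (v' t))) w' v' A') :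
    IsDiagonalWave e μ T
      (fun t => -((a - a') (w t) + (b - b') (v t)) - a' ((w - w') t) - b' ((v - v') t))
      (w - w') (v - v') (A - A') :=
  (hw.sub hw').congr_forcing fun t _ => by
    simp only [Pi.sub_apply, map_sub, sub_apply]
    abel

lemma norm_coefficients_le [Countable ι]
    (hw : IsDiagonalWave e μ T (fun t => -(a (w t) + b (v t))) w v A) (hδ : 0 < δ)
    (hμ : ∀ i, δ ≤ μ i) (ha : a.IsPositive) (hb : ∀ f, 0 ≤ b.reApplyInnerSelf f)
    (c d : H →L[ℂ] H) (ht : t ∈ Icc 0 T) :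
    ‖c (w t) + d (v t)‖ ≤ (‖c‖ + ‖d‖) * ((1 + δ⁻¹) *
      (Real.exp T * ((1 + ‖a‖) * (‖v 0‖ + (1 + δ⁻¹) * ‖A 0‖)))) := by
  have h0 : (0 : ℝ) ∈ Icc 0 T := ⟨le_rfl, ht.1.trans ht.2⟩
  set B := Real.exp T * ((1 + ‖a‖) * (‖v 0‖ + (1 + δ⁻¹) * ‖A 0‖)) with hB
  have hδ' : 0 ≤ δ⁻¹ := (inv_pos.2 hδ).le
  have hB0 : 0 ≤ B := by positivity
  have hw0 := hw.norm_le hδ hμ h0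
  have hforced : IsDiagonalWave e μ T (fun t => 0 - a (w t) - b (v t)) w v A :=
    hw.congr_forcing fun t _ => by simp only [zero_sub, neg_add']
  obtain ⟨hv, hA⟩ := hforced.norm_le_and_norm_le (R := 0) ha hb continuousOn_const
    (fun _ _ => norm_zero.le) ht
  have hdata : Real.exp T * ((1 + ‖a‖) * (‖v 0‖ + ‖A 0‖ + ‖w 0‖ + 0)) ≤ B := by
    rw [hB]; gcongr Real.exp T * ((1 + ‖a‖) * ?_); linarith
  have hvM : ‖v t‖ ≤ (1 + δ⁻¹) * B := by nlinarith
  have hwM : ‖w t‖ ≤ (1 + δ⁻¹) * B :=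
    calc ‖w t‖ ≤ δ⁻¹ * ‖A t‖ := hw.norm_le hδ hμ ht
      _ ≤ δ⁻¹ * B := by gcongr; exact hA.trans hdata
      _ ≤ (1 + δ⁻¹) * B := by gcongr; linarith
  calc ‖c (w t) + d (v t)‖ ≤ ‖c (w t)‖ + ‖d (v t)‖ := norm_add_le _ _
    _ ≤ ‖c‖ * ((1 + δ⁻¹) * B) + ‖d‖ * ((1 + δ⁻¹) * B) :=
        add_le_add (c.le_opNorm_of_le hwM) (d.le_opNorm_of_le hvM)
    _ = (‖c‖ + ‖d‖) * ((1 + δ⁻¹) * B) := by ring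

lemma norm_sub_le [Countable ι]
    (hw : IsDiagonalWave e μ T (fun t => -(a (w t) + b (v t))) w v A)
    (hw' : IsDiagonalWave e μ T (fun t => -(a' (w' t) + b' (v' t))) w' v' A')
    (hδ : 0 < δ) (hμ : ∀ i, δ ≤ μ i) (ha : a.IsPositive) (ha' : a'.IsPositive)
    (hb : ∀ f, 0 ≤ b.reApplyInnerSelf f) (hb' : ∀ f, 0 ≤ b'.reApplyInnerSelf f)
    (ht : t ∈ Icc 0 T) :
    ‖A t - A' t‖ ≤ Real.exp T * ((1 + ‖a'‖) * (‖v 0 - v' 0‖ + (1 + δ⁻¹) * ‖A 0 - A' 0‖ +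
      (‖a - a'‖ + ‖b - b'‖) * ((1 + δ⁻¹) *
        (Real.exp T * ((1 + ‖a‖) * (‖v 0‖ + (1 + δ⁻¹) * ‖A 0‖)))))) := by
  have h0 : (0 : ℝ) ∈ Icc 0 T := ⟨le_rfl, ht.1.trans ht.2⟩
  have hsub := hw.sub_of_coefficients hw'
  have hforcing : ContinuousOn (fun t => -((a - a') (w t) + (b - b') (v t))) (Icc 0 T) :=
    (((a - a').continuous.comp_continuousOn hw.continuousOn).add
      ((b - b').continuous.comp_continuousOn hw.continuousOn_velocity)).neg
  refine (hsub.norm_le_and_norm_le ha' hb' hforcing (fun τ hτ => (norm_neg _).trans_le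
    (hw.norm_coefficients_le hδ hμ ha hb (a - a') (b - b') hτ)) ht).2.trans ?_
  gcongr Real.exp T * ((1 + ‖a'‖) * ?_)
  have hsub0 := hsub.norm_le hδ hμ h0
  simp only [Pi.sub_apply] at hsub0 ⊢
  linarith

end IsDiagonalWave

end Energy

/-! ### Primitives on the unit interval -/

instance isProbabilityMeasure_μ01 : IsProbabilityMeasure μ01 := ⟨by simp [μ01]⟩

lemma ae_mem_Ioo : ∀ᵐ x ∂μ01, x ∈ Ioo (0 : ℝ) 1 := ae_restrict_mem measurableSet_Ioo

lemma ae_restrict_Ioc_of_ae_μ01 {P : ℝ → Prop} (h : ∀ᵐ x ∂μ01, P x) {x y : ℝ} (hx : 0 ≤ x)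
    (hy : y ≤ 1) : ∀ᵐ t ∂(volume.restrict (Ioc x y)), P t := by
  have hIoc : ∀ᵐ x ∂(volume.restrict (Ioc (0 : ℝ) 1)), P x := by
    rwa [← restrict_Ioo_eq_restrict_Ioc]
  exact ae_restrict_of_ae_restrict_of_subset (Ioc_subset_Ioc hx hy) hIoc

lemma intervalIntegrable_of_integrable_μ01 {E : Type*} [NormedAddCommGroup E] {f : ℝ → E} {x y : ℝ}
    (hf : Integrable f μ01) (hx : x ∈ Icc (0 : ℝ) 1) (hy : y ∈ Icc (0 : ℝ) 1) :
    IntervalIntegrable f volume x y := by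
  have h : IntegrableOn f (Ioo 0 1) := hf
  rw [← integrableOn_Icc_iff_integrableOn_Ioo] at h
  refine (intervalIntegrable_iff_integrableOn_Icc_of_le zero_le_one |>.2 h).mono_set ?_
  rw [uIcc_of_le (zero_le_one' ℝ)]
  exact uIcc_subset_Icc hx hy

section Primitive

variable {E : Type*} [NormedAddCommGroup E] [NormedSpace ℝ E] {f g : ℝ → E} {x y : ℝ}

/-- The primitive of `f` that vanishes at `0`. -/
def primitive (f : ℝ → E) (x : ℝ) : E := ∫ t in (0 : ℝ)..x, f t

@[simp]
lemma primitive_zero (f : ℝ → E) : primitive f 0 = 0 := intervalIntegral.integral_same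

lemma primitive_congr (h : f =ᵐ[μ01] g) (hx : x ∈ Icc (0 : ℝ) 1) :
    primitive f x = primitive g x := by
  rw [primitive, primitive, intervalIntegral.integral_of_le hx.1,
    intervalIntegral.integral_of_le hx.1]
  exact integral_congr_ae (ae_restrict_Ioc_of_ae_μ01 h le_rfl hx.2)

lemma primitive_sub_primitive (hf : Integrable f μ01) (hx : x ∈ Icc (0 : ℝ) 1)
    (hy : y ∈ Icc (0 : ℝ) 1) : primitive f y - primitive f x = ∫ t in x..y, f t :=
  intervalIntegral.integral_interval_sub_left
    (intervalIntegrable_of_integrable_μ01 hf (by simp) hy)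
    (intervalIntegrable_of_integrable_μ01 hf (by simp) hx)

lemma continuousOn_primitive (hf : Integrable f μ01) : ContinuousOn (primitive f) (Icc 0 1) := by
  have h := intervalIntegral.continuousOn_primitive_interval'
    (intervalIntegrable_of_integrable_μ01 hf (x := 0) (y := 1) (by simp) (by simp)) left_mem_uIcc
  rwa [uIcc_of_le (zero_le_one' ℝ)] at h

lemma primitive_eq_setIntegral_Iio (f : ℝ → E) (hx : x ∈ Ioo (0 : ℝ) 1) :
    primitive f x = ∫ t in Iio x, f t ∂μ01 := by
  rw [primitive, intervalIntegral.integral_of_le hx.1.le, integral_Ioc_eq_integral_Ioo,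
    Measure.restrict_restrict measurableSet_Iio, inter_comm, Ioo_inter_Iio, min_eq_right hx.2.le]

lemma primitive_one_sub_eq_setIntegral_Ioi (hf : Integrable f μ01) (hx : x ∈ Ioo (0 : ℝ) 1) :
    primitive f 1 - primitive f x = ∫ t in Ioi x, f t ∂μ01 := by
  rw [primitive_sub_primitive hf (Ioo_subset_Icc_self hx) (by simp),
    intervalIntegral.integral_of_le hx.2.le, integral_Ioc_eq_integral_Ioo,
    Measure.restrict_restrict measurableSet_Ioi, inter_comm, Ioo_inter_Ioi, max_eq_right hx.1.le]

lemma eq_primitive_of_hasDerivWithinAt [CompleteSpace E] {Y Z : ℝ → E}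
    (hZ : ContinuousOn Z (Icc 0 1)) (h0 : Y 0 = 0)
    (hY : ∀ x ∈ Icc (0 : ℝ) 1, HasDerivWithinAt Y (Z x) (Icc 0 1) x) (hx : x ∈ Icc (0 : ℝ) 1) :
    Y x = primitive Z x := by
  have hsub : Icc 0 x ⊆ Icc 0 1 := Icc_subset_Icc_right hx.2
  have hftc := intervalIntegral.integral_eq_sub_of_hasDerivAt_of_le (f := Y) (f' := Z) hx.1
    (fun y hy => ((hY y (hsub hy)).mono hsub).continuousWithinAt)
    (fun y hy => (hY y (hsub (Ioo_subset_Icc_self hy))).hasDerivAt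
      (Icc_mem_nhds hy.1 (hy.2.trans_le hx.2)))
    (ContinuousOn.intervalIntegrable (by rw [uIcc_of_le hx.1]; exact hZ.mono hsub))
  rw [primitive, hftc, h0, sub_zero]

lemma ae_eq_zero_of_primitive_ae_eq_const [CompleteSpace E] {c : E} (hf : Integrable f μ01)
    (h : primitive f =ᵐ[μ01] fun _ => c) : f =ᵐ[μ01] 0 := by
  have hconst : EqOn (primitive f) (fun _ => c) (Ioo 0 1) :=
    Measure.eqOn_open_of_ae_eq (μ := volume) h isOpen_Ioo
      ((continuousOn_primitive hf).mono Ioo_subset_Icc_self) continuousOn_const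
  have hderiv := (intervalIntegrable_of_integrable_μ01 hf (x := 0) (y := 1)
    (by simp) (by simp)).ae_hasDerivAt_integral
  filter_upwards [ae_restrict_of_ae hderiv, ae_mem_Ioo] with x hfx hx
  have hfx' : HasDerivAt (primitive f) (f x) x :=
    hfx (by rw [uIcc_of_le zero_le_one]; exact Ioo_subset_Icc_self hx) 0 (by simp)
  exact hfx'.unique ((hasDerivAt_const x c).congr_of_eventuallyEq
    (hconst.eventuallyEq_of_mem (isOpen_Ioo.mem_nhds hx)))

end Primitive

lemma integrable_L2 (f : L2) : Integrable f μ01 := (Lp.memLp f).integrable one_le_two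

lemma memLp_of_continuousOn {F : ℝ → ℂ} (hF : ContinuousOn F (Icc 0 1)) : MemLp F 2 μ01 := by
  obtain ⟨C, hC⟩ := isCompact_Icc.exists_bound_of_continuousOn hF
  refine MemLp.of_bound ((hF.mono Ioo_subset_Icc_self).aestronglyMeasurable measurableSet_Ioo) C ?_
  filter_upwards [ae_mem_Ioo] with x hx using hC x (Ioo_subset_Icc_self hx)

lemma memLp_primitive (f : L2) : MemLp (primitive f) 2 μ01 :=
  memLp_of_continuousOn (continuousOn_primitive (integrable_L2 f))

lemma norm_le_of_ae_norm_le {f : L2} {C : ℝ} (hC : 0 ≤ C) (h : ∀ᵐ x ∂μ01, ‖f x‖ ≤ C) :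
    ‖f‖ ≤ C := by
  simpa [measureUnivNNReal] using Lp.norm_le_of_ae_bound hC h

lemma inner_indicator_Ioc (f : L2) {x y : ℝ} (hx : 0 ≤ x) (hxy : x ≤ y) (hy : y ≤ 1) :
    ⟪(indicatorConstLp 2 measurableSet_Ioc (measure_ne_top μ01 (Ioc x y)) (1 : ℂ) : L2), f⟫_ℂ =
      ∫ t in x..y, f t := by
  have hrestrict : μ01.restrict (Ioc x y) = volume.restrict (Ioc x y) := by
    rw [μ01, restrict_Ioo_eq_restrict_Ioc, Measure.restrict_restrict measurableSet_Ioc,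
      inter_eq_self_of_subset_left (Ioc_subset_Ioc hx hy)]
  rw [L2.inner_indicatorConstLp_eq_inner_setIntegral ℂ, intervalIntegral.integral_of_le hxy,
    hrestrict]
  simp only [RCLike.inner_apply, map_one, mul_one]

lemma norm_integral_le_sqrt (f : L2) {x y : ℝ} (hx : 0 ≤ x) (hxy : x ≤ y) (hy : y ≤ 1) :
    ‖∫ t in x..y, f t‖ ≤ √(y - x) * ‖f‖ := by
  rw [← inner_indicator_Ioc f hx hxy hy]
  refine (norm_inner_le_norm _ _).trans (mul_le_mul_of_nonneg_right ?_ (norm_nonneg _))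
  rw [norm_indicatorConstLp (by norm_num) (by norm_num)]
  simp only [norm_one, one_mul, ENNReal.toReal_ofNat, ← Real.sqrt_eq_rpow]
  refine Real.sqrt_le_sqrt ?_
  calc μ01.real (Ioc x y) ≤ volume.real (Ioc x y) :=
        ENNReal.toReal_mono (by simp) (Measure.restrict_apply_le _ _)
    _ = y - x := by simp [hxy]

lemma norm_primitive_le (f : L2) {x : ℝ} (hx : x ∈ Icc (0 : ℝ) 1) : ‖primitive f x‖ ≤ ‖f‖ :=
  (norm_integral_le_sqrt f le_rfl hx.1 hx.2).trans
    (mul_le_of_le_one_left (norm_nonneg _) (Real.sqrt_le_one.2 (by linarith [hx.2])))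

/-! ### The Volterra operator -/

/-- The Volterra operator: `f` is mapped to its primitive that vanishes at `0`. -/
def volterra : L2 →L[ℂ] L2 :=
  LinearMap.mkContinuous
    { toFun := fun f => (memLp_primitive f).toLp (primitive f)
      map_add' := fun f g => by
        rw [← MemLp.toLp_add]
        refine MemLp.toLp_congr _ _ ?_
        filter_upwards [ae_mem_Ioo] with x hx
        have hx' := Ioo_subset_Icc_self hx
        rw [primitive_congr (Lp.coeFn_add f g) hx']
        exact intervalIntegral.integral_add
          (intervalIntegrable_of_integrable_μ01 (integrable_L2 f) (by simp) hx')
          (intervalIntegrable_of_integrable_μ01 (integrable_L2 g) (by simp) hx')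
      map_smul' := fun c f => by
        rw [RingHom.id_apply, ← MemLp.toLp_const_smul]
        refine MemLp.toLp_congr _ _ ?_
        filter_upwards [ae_mem_Ioo] with x hx
        rw [primitive_congr (Lp.coeFn_smul c f) (Ioo_subset_Icc_self hx)]
        exact intervalIntegral.integral_smul c f }
    1 fun f => by
      rw [one_mul]
      refine norm_le_of_ae_norm_le (norm_nonneg _) ?_
      filter_upwards [(memLp_primitive f).coeFn_toLp, ae_mem_Ioo] with x hf hx
      exact hf.symm ▸ norm_primitive_le f (Ioo_subset_Icc_self hx)

lemma coeFn_volterra (f : L2) : volterra f =ᵐ[μ01] primitive f := (memLp_primitive f).coeFn_toLp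

/-- The index `k` of the interval `[k / (n + 1), (k + 1) / (n + 1))` that contains `x ∈ [0, 1)`. -/
def stepIndex (n : ℕ) (x : ℝ) : Fin (n + 1) := Fin.ofNat (n + 1) ⌊((n : ℝ) + 1) * x⌋₊

lemma measurable_stepIndex (n : ℕ) : Measurable (stepIndex n) :=
  (Measurable.of_discrete (f := Fin.ofNat (n + 1))).comp
    (Nat.measurable_floor.comp (measurable_const_mul ((n : ℝ) + 1)))

lemma stepIndex_div_mem_Icc (n : ℕ) {x : ℝ} (hx : x ∈ Ico (0 : ℝ) 1) :
    (stepIndex n x : ℝ) / (n + 1) ∈ Icc (x - 1 / (n + 1)) x := by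
  have hn : (0 : ℝ) < n + 1 := by positivity
  have hfloor : ⌊((n : ℝ) + 1) * x⌋₊ < n + 1 := by
    rw [Nat.floor_lt (mul_nonneg hn.le hx.1)]
    push_cast
    nlinarith [hx.2]
  have hindex : (stepIndex n x : ℕ) = ⌊((n : ℝ) + 1) * x⌋₊ := Nat.mod_eq_of_lt hfloor
  rw [hindex, mem_Icc, sub_le_iff_le_add, ← add_div, le_div_iff₀ hn, div_le_iff₀ hn, mul_comm x]
  exact ⟨(Nat.lt_floor_add_one _).le, Nat.floor_le (mul_nonneg hn.le hx.1)⟩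

lemma memLp_comp_stepIndex (n : ℕ) (c : Fin (n + 1) → ℂ) :
    MemLp (fun x => c (stepIndex n x)) 2 μ01 :=
  MemLp.of_bound
    ((Measurable.of_discrete (f := c)).comp (measurable_stepIndex n)).aestronglyMeasurable
    ‖c‖ (ae_of_all _ fun _ => norm_le_pi_norm c _)

/-- Step functions with `n + 1` steps of equal length. -/
def stepMap (n : ℕ) : (Fin (n + 1) → ℂ) →ₗ[ℂ] L2 where
  toFun c := (memLp_comp_stepIndex n c).toLp _
  map_add' _ _ := rfl
  map_smul' _ _ := rfl

lemma coeFn_stepMap (n : ℕ) (c : Fin (n + 1) → ℂ) :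
    stepMap n c =ᵐ[μ01] fun x => c (stepIndex n x) :=
  (memLp_comp_stepIndex n c).coeFn_toLp

/-- The values of the primitive at the points `k / (n + 1)`. -/
def samples (n : ℕ) : L2 →L[ℂ] (Fin (n + 1) → ℂ) :=
  ContinuousLinearMap.pi fun k => innerSL ℂ
    (indicatorConstLp 2 measurableSet_Ioc (measure_ne_top μ01 (Ioc 0 ((k : ℝ) / (n + 1)))) (1 : ℂ))

lemma samples_apply (n : ℕ) (f : L2) (k : Fin (n + 1)) :
    samples n f k = primitive f ((k : ℝ) / (n + 1)) := by
  have hk : (k : ℝ) ≤ n := by exact_mod_cast Nat.lt_succ_iff.1 k.2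
  exact inner_indicator_Ioc f le_rfl (by positivity) (by rw [div_le_one (by positivity)]; linarith)

lemma norm_volterra_sub_stepMap_le (n : ℕ) :
    ‖volterra - (stepMap n).toContinuousLinearMap ∘L samples n‖ ≤ √(1 / ((n : ℝ) + 1)) := by
  refine ContinuousLinearMap.opNorm_le_bound _ (by positivity) fun f => ?_
  refine norm_le_of_ae_norm_le (by positivity) ?_
  filter_upwards [Lp.coeFn_sub (volterra f) (stepMap n (samples n f)), coeFn_volterra f,
    coeFn_stepMap n (samples n f), ae_mem_Ioo] with x hsub hvolterra hstep hx
  obtain ⟨hlower, hupper⟩ := stepIndex_div_mem_Icc n (Ioo_subset_Ico_self hx)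
  have hnonneg : (0 : ℝ) ≤ stepIndex n x / (n + 1) := by positivity
  change ‖(volterra f - stepMap n (samples n f) : L2) x‖ ≤ _
  rw [hsub, Pi.sub_apply, hvolterra, hstep, samples_apply, primitive_sub_primitive
    (integrable_L2 f) ⟨hnonneg, hupper.trans hx.2.le⟩ (Ioo_subset_Icc_self hx)]
  refine (norm_integral_le_sqrt f hnonneg hupper hx.2.le).trans ?_
  gcongr
  linarith

lemma isCompactOperator_volterra : IsCompactOperator volterra := by
  have hrank : ∀ n : ℕ, IsCompactOperator ((stepMap n).toContinuousLinearMap ∘L samples n) :=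
    fun n => (isCompactOperator_of_locallyCompactSpace_rng
      (stepMap n).toContinuousLinearMap).comp_clm (samples n)
  have hbound : Tendsto (fun n : ℕ => √(1 / ((n : ℝ) + 1))) atTop (𝓝 0) := by
    simpa only [Real.sqrt_zero, Function.comp_def] using
      (Real.continuous_sqrt.tendsto 0).comp (tendsto_one_div_add_atTop_nhds_zero_nat (𝕜 := ℝ))
  refine isCompactOperator_of_tendsto (l := atTop) ?_ (Eventually.of_forall hrank)
  rw [tendsto_iff_norm_sub_tendsto_zero]
  exact squeeze_zero (fun _ => norm_nonneg _) (fun n => by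
    rw [norm_sub_rev]; exact norm_volterra_sub_stepMap_le n) hbound

lemma integral_setIntegral_Iio_eq {α E : Type*} [MeasurableSpace α] [TopologicalSpace α]
    [LinearOrder α] [OrderClosedTopology α] [SecondCountableTopology α] [OpensMeasurableSpace α]
    [NormedAddCommGroup E] [NormedSpace ℝ E] {μ : Measure α} [SFinite μ] {F : α → α → E}
    (hF : Integrable (Function.uncurry F) (μ.prod μ)) :
    ∫ x, ∫ t in Iio x, F x t ∂μ ∂μ = ∫ t, ∫ x in Ioi t, F x t ∂μ ∂μ := by
  simp_rw [← integral_indicator measurableSet_Iio, ← integral_indicator measurableSet_Ioi]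
  exact integral_integral_swap
    (hF.indicator (measurableSet_lt measurable_snd measurable_fst))

/-- The constant function `1`. -/
def oneL2 : L2 := Lp.const 2 μ01 (1 : ℂ)

lemma coeFn_oneL2 : oneL2 =ᵐ[μ01] fun _ => 1 := Lp.coeFn_const ..

lemma inner_oneL2 (f : L2) : ⟪oneL2, f⟫_ℂ = primitive f 1 := by
  rw [L2.inner_def, primitive, intervalIntegral.integral_of_le zero_le_one,
    ← restrict_Ioo_eq_restrict_Ioc]
  refine integral_congr_ae ?_
  filter_upwards [coeFn_oneL2] with x hx
  rw [hx, RCLike.inner_apply, map_one, mul_one]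

/-- The projection onto the constant functions. -/
def meanL2 : L2 →L[ℂ] L2 := (innerSL ℂ oneL2).smulRight oneL2

lemma coeFn_meanL2 (f : L2) : meanL2 f =ᵐ[μ01] fun _ => primitive f 1 := by
  filter_upwards [Lp.coeFn_smul ⟪oneL2, f⟫_ℂ oneL2, coeFn_oneL2] with x hsmul hone
  change (⟪oneL2, f⟫_ℂ • oneL2 : L2) x = _
  rw [hsmul, Pi.smul_apply, hone, inner_oneL2, smul_eq_mul, mul_one]

lemma inner_meanL2 (f g : L2) : ⟪meanL2 f, g⟫_ℂ = ⟪f, meanL2 g⟫_ℂ := by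
  simp [meanL2, inner_smul_left, inner_smul_right, mul_comm]

lemma meanL2_meanL2 (f : L2) : meanL2 (meanL2 f) = meanL2 f := by
  have hone : ⟪oneL2, oneL2⟫_ℂ = 1 := by
    rw [inner_oneL2, primitive_congr coeFn_oneL2 (by simp)]
    simp [primitive]
  simp only [meanL2, ContinuousLinearMap.smulRight_apply, innerSL_apply_apply, inner_smul_right,
    hone, mul_one]

lemma inner_volterra (f g : L2) : ⟪volterra f, g⟫_ℂ = ⟪f, meanL2 g - volterra g⟫_ℂ := by
  have hleft : ⟪volterra f, g⟫_ℂ =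
      ∫ x, ∫ t in Iio x, g x * starRingEnd ℂ (f t) ∂μ01 ∂μ01 := by
    rw [L2.inner_def]
    refine integral_congr_ae ?_
    filter_upwards [coeFn_volterra f, ae_mem_Ioo] with x hf hx
    rw [hf, primitive_eq_setIntegral_Iio f hx, RCLike.inner_apply, integral_const_mul,
      integral_conj]
  have hright : ⟪f, meanL2 g - volterra g⟫_ℂ =
      ∫ t, ∫ x in Ioi t, g x * starRingEnd ℂ (f t) ∂μ01 ∂μ01 := by
    rw [L2.inner_def]
    refine integral_congr_ae ?_
    filter_upwards [Lp.coeFn_sub (meanL2 g) (volterra g), coeFn_meanL2 g, coeFn_volterra g,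
      ae_mem_Ioo] with t hsub hmean hg ht
    rw [hsub, Pi.sub_apply, hmean, hg, primitive_one_sub_eq_setIntegral_Ioi (integrable_L2 g) ht,
      RCLike.inner_apply, integral_mul_const]
  rw [hleft, hright]
  exact integral_setIntegral_Iio_eq (Integrable.mul_prod (integrable_L2 g)
    ((RCLike.conjLIE (K := ℂ)).toContinuousLinearEquiv.toContinuousLinearMap.integrable_comp
      (integrable_L2 f)))

/-! ### Multiplication operators -/

/-- Multiplication by a bounded function. -/
def mulOp (q : Linf) : L2 →L[ℂ] L2 :=
  LinearMap.mkContinuous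
    { toFun := fun f => (q • f : L2)
      map_add' := fun f g => Lp.add_smul q f g
      map_smul' := fun c f => by
        refine Lp.ext ?_
        filter_upwards [Lp.coeFn_lpSMul (r := 2) q (c • f), Lp.coeFn_smul c (q • f : L2),
          Lp.coeFn_lpSMul (r := 2) q f, Lp.coeFn_smul c f] with x hq hc hqf hcf
        simp only [hq, hc, hqf, hcf, RingHom.id_apply, Pi.smul_apply', Pi.smul_apply, smul_comm c] }
    ‖q‖ fun f => Lp.norm_smul_le q f

lemma mulOp_apply (q : Linf) (f : L2) : mulOp q f = (q • f : L2) := rfl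

lemma norm_mulOp_le (q : Linf) : ‖mulOp q‖ ≤ ‖q‖ :=
  LinearMap.mkContinuous_norm_le _ (norm_nonneg q) _

lemma mulOp_sub (a b : Linf) : mulOp (a - b) = mulOp a - mulOp b := by
  ext1 f
  change ((a - b) • f : L2) = a • f - b • f
  rw [sub_eq_add_neg, Lp.smul_add, Lp.neg_smul, ← sub_eq_add_neg]

lemma coeFn_mulOp (q : Linf) (f : L2) : mulOp q f =ᵐ[μ01] fun x => (q x : ℂ) * f x := by
  filter_upwards [Lp.coeFn_lpSMul (r := 2) q f] with x hx
  rw [mulOp_apply, hx, Pi.smul_apply', Complex.real_smul]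

lemma inner_mulOp (q : Linf) (f g : L2) : ⟪mulOp q f, g⟫_ℂ = ⟪f, mulOp q g⟫_ℂ := by
  rw [L2.inner_def, L2.inner_def]
  refine integral_congr_ae ?_
  filter_upwards [coeFn_mulOp q f, coeFn_mulOp q g] with x hf hg
  rw [hf, hg, RCLike.inner_apply, RCLike.inner_apply, map_mul, Complex.conj_ofReal]
  ring

lemma isPositive_mulOp {a : Linf} (ha : 0 ≤ a) : (mulOp a).IsPositive := by
  refine ⟨inner_mulOp a, fun f => ?_⟩
  rw [ContinuousLinearMap.reApplyInnerSelf_apply, L2.inner_def,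
    ← integral_re (L2.integrable_inner (𝕜 := ℂ) (mulOp a f) f)]
  refine integral_nonneg_of_ae ?_
  filter_upwards [coeFn_mulOp a f, (Lp.coeFn_nonneg a).2 ha] with x hf hax
  have hpointwise : ⟪mulOp a f x, f x⟫_ℂ = ((a x * ‖f x‖ ^ 2 : ℝ) : ℂ) := by
    rw [hf, RCLike.inner_apply, map_mul, Complex.conj_ofReal, mul_left_comm, RCLike.mul_conj]
    simp
  rw [hpointwise]
  exact mul_nonneg hax (sq_nonneg _)

/-! ### The Dirichlet problem -/

/-- The derivative of the solution of `-y'' = h`, `y 0 = y 1 = 0`. -/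
def dirichletSlope (h : ℝ → ℂ) (x : ℝ) : ℂ := primitive (primitive h) 1 - primitive h x

lemma continuousOn_dirichletSlope {h : ℝ → ℂ} (hh : Integrable h μ01) :
    ContinuousOn (dirichletSlope h) (Icc 0 1) :=
  continuousOn_const.sub (continuousOn_primitive hh)

lemma primitive_const_sub_primitive_one {h : ℝ → ℂ} (hh : Integrable h μ01) (c : ℂ) :
    primitive (fun x => c - primitive h x) 1 = c - primitive (primitive h) 1 := by
  have hint : IntervalIntegrable (primitive h) volume 0 1 :=
    ContinuousOn.intervalIntegrable (by
      rw [uIcc_of_le zero_le_one]; exact continuousOn_primitive hh)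
  rw [primitive, intervalIntegral.integral_sub intervalIntegrable_const hint]
  simp [primitive]

lemma primitive_dirichletSlope_one {h : ℝ → ℂ} (hh : Integrable h μ01) :
    primitive (dirichletSlope h) 1 = 0 :=
  (primitive_const_sub_primitive_one hh _).trans (sub_self _)

/-- The solution operator of `-y'' = h`, `y 0 = y 1 = 0`. -/
def green : L2 →L[ℂ] L2 := volterra ∘L (meanL2 - 1) ∘L volterra

lemma coeFn_green (h : L2) : green h =ᵐ[μ01] primitive (dirichletSlope h) := by
  have hslope : (meanL2 (volterra h) - volterra h : L2) =ᵐ[μ01] dirichletSlope h := by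
    filter_upwards [Lp.coeFn_sub (meanL2 (volterra h)) (volterra h), coeFn_meanL2 (volterra h),
      coeFn_volterra h] with x hsub hmean hvolterra
    rw [hsub, Pi.sub_apply, hmean, hvolterra, primitive_congr (coeFn_volterra h) (by simp),
      dirichletSlope]
  filter_upwards [coeFn_volterra (meanL2 (volterra h) - volterra h), ae_mem_Ioo] with x hgreen hx
  exact hgreen.trans (primitive_congr hslope (Ioo_subset_Icc_self hx))

lemma isCompactOperator_green : IsCompactOperator green :=
  isCompactOperator_volterra.comp_clm ((meanL2 - 1) ∘L volterra)

lemma isSymmetric_green : (green : L2 →ₗ[ℂ] L2).IsSymmetric := by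
  have hform : ∀ f g : L2, ⟪green f, g⟫_ℂ = ⟪volterra f, volterra g - meanL2 (volterra g)⟫_ℂ :=
    fun f g => by
      change ⟪volterra (meanL2 (volterra f) - volterra f), g⟫_ℂ = _
      simp only [inner_volterra (meanL2 _ - _), inner_sub_left, inner_sub_right, inner_meanL2,
        meanL2_meanL2]
      ring
  intro f g
  change ⟪green f, g⟫_ℂ = ⟪f, green g⟫_ℂ
  rw [← inner_conj_symm f, hform, hform, inner_conj_symm, inner_sub_left, inner_sub_right,
    inner_meanL2]

lemma eq_zero_of_green_eq_zero {h : L2} (hh : green h = 0) : h = 0 := by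
  have hsecond : primitive (dirichletSlope h) =ᵐ[μ01] fun _ => 0 := by
    filter_upwards [coeFn_green h, Lp.coeFn_zero ℂ 2 μ01] with x hgreen hzero
    rw [← hgreen, hh, hzero, Pi.zero_apply]
  have hslope := ae_eq_zero_of_primitive_ae_eq_const
    ((memLp_of_continuousOn (continuousOn_dirichletSlope (integrable_L2 h))).integrable one_le_two)
    hsecond
  have hfirst : primitive h =ᵐ[μ01] fun _ => primitive (primitive h) 1 := by
    filter_upwards [hslope] with x hx using (sub_eq_zero.1 hx).symm
  exact (Lp.eq_zero_iff_ae_eq_zero).2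
    (ae_eq_zero_of_primitive_ae_eq_const (integrable_L2 h) hfirst)

section SturmLiouville

variable {q : Linf} {y y' g g' : L2}

lemma integral_potential_sub {Y : ℝ → ℂ} (hY : y =ᵐ[μ01] Y) {x : ℝ} (hx : x ∈ Icc (0 : ℝ) 1) :
    ∫ t in (0 : ℝ)..x, ((q t : ℂ) * Y t - g t) = -primitive (g - mulOp q y : L2) x := by
  rw [primitive, ← intervalIntegral.integral_neg]
  refine primitive_congr ?_ hx
  filter_upwards [Lp.coeFn_sub g (mulOp q y), coeFn_mulOp q y, hY] with t hsub hmul hYt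
  rw [hsub, Pi.sub_apply, hmul, hYt, neg_sub]

lemma SL.ae_eq (hy : SL q y g) : y =ᵐ[μ01] primitive (dirichletSlope (g - mulOp q y : L2)) := by
  obtain ⟨Y, Z, hyY, hY0, hY1, hY, hZ⟩ := hy
  set h : L2 := g - mulOp q y
  have hh := integrable_L2 h
  have hZh : EqOn Z (fun x => Z 0 - primitive h x) (Icc 0 1) := fun x hx => by
    rw [hZ x hx, integral_potential_sub hyY hx]
    exact (sub_eq_add_neg _ _).symm
  have hYZ : ∀ x ∈ Icc (0 : ℝ) 1, Y x = primitive (fun x => Z 0 - primitive h x) x := fun x hx =>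
    eq_primitive_of_hasDerivWithinAt (continuousOn_const.sub (continuousOn_primitive hh)) hY0
      (fun t ht => (hY t ht).congr_deriv (hZh ht)) hx
  have hslope : Z 0 = primitive (primitive h) 1 := by
    rw [← sub_eq_zero, ← primitive_const_sub_primitive_one hh, ← hYZ 1 (by simp), hY1]
  filter_upwards [hyY, ae_mem_Ioo] with x hx hx01
  rw [hx, hYZ x (Ioo_subset_Icc_self hx01), hslope]
  rfl

lemma SL.of_ae_eq (hy : y =ᵐ[μ01] primitive (dirichletSlope (g - mulOp q y : L2))) :
    SL q y g := by
  have hh := integrable_L2 (g - mulOp q y)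
  refine ⟨_, dirichletSlope (g - mulOp q y : L2), hy, primitive_zero _,
    primitive_dirichletSlope_one hh,
    fun x hx => hasDerivWithinAt_integral_Icc (continuousOn_dirichletSlope hh) hx,
    fun x hx => ?_⟩
  rw [integral_potential_sub hy hx, dirichletSlope, dirichletSlope, primitive_zero, sub_zero,
    sub_eq_add_neg]

lemma SL_iff_eq_green : SL q y g ↔ y = green (g - mulOp q y) :=
  ⟨fun hy => Lp.ext (hy.ae_eq.trans (coeFn_green _).symm),
    fun hy => SL.of_ae_eq (by conv_lhs => rw [hy]
                              exact coeFn_green _)⟩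

lemma SL.smul (c : ℂ) (hy : SL q y g) : SL q (c • y) (c • g) := by
  rw [SL_iff_eq_green] at hy ⊢
  rw [map_smul, ← smul_sub, map_smul, ← hy]

lemma SL.inner_eq (hy : SL q y g) (hy' : SL q y' g') : ⟪g, y'⟫_ℂ = ⟪y, g'⟫_ℂ := by
  rw [SL_iff_eq_green] at hy hy'
  have hgreen : ⟪g - mulOp q y, y'⟫_ℂ = ⟪y, g' - mulOp q y'⟫_ℂ :=
    calc ⟪g - mulOp q y, y'⟫_ℂ = ⟪g - mulOp q y, green (g' - mulOp q y')⟫_ℂ := by rw [← hy']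
      _ = ⟪green (g - mulOp q y), g' - mulOp q y'⟫_ℂ := (isSymmetric_green _ _).symm
      _ = ⟪y, g' - mulOp q y'⟫_ℂ := by rw [← hy]
  rwa [inner_sub_left, inner_sub_right, inner_mulOp, sub_left_inj] at hgreen

end SturmLiouville

/-! ### Eigenfunction expansions and fractional powers -/

section Eigenfunctions

variable {q : Linf}

lemma IsEigenpair.inner_eq_zero {l l' : ℝ} {φ φ' : L2} (h : IsEigenpair q l φ)
    (h' : IsEigenpair q l' φ') (hne : l ≠ l') : ⟪φ, φ'⟫_ℂ = 0 := by
  have hsymm := h.2.inner_eq h'.2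
  rw [inner_smul_left, inner_smul_right, Complex.conj_ofReal] at hsymm
  by_contra hinner
  exact hne (by exact_mod_cast mul_right_cancel₀ hinner hsymm)

lemma IsEigenpair.isTest {l : ℝ} {φ : L2} (h : IsEigenpair q l φ) : IsTest q φ :=
  ⟨fun j => ((l : ℂ) ^ j) • φ, by simp, fun j => by
    simpa only [smul_smul, ← pow_succ] using h.2.smul ((l : ℂ) ^ j)⟩

lemma IsEigenpair.isPow {l : ℝ} {φ : L2} (h : IsEigenpair q l φ) (r : ℝ) :
    IsPow q r φ (((l ^ r : ℝ) : ℂ) • φ) := by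
  intro l' φ' h'
  rw [inner_smul_right]
  rcases eq_or_ne l' l with rfl | hne
  · rfl
  · rw [h'.inner_eq_zero h hne, mul_zero, mul_zero]

lemma SL.eq_zero_of_zero {g : L2} (h : SL q 0 g) : g = 0 := by
  rw [SL_iff_eq_green, map_zero, sub_zero] at h
  exact eq_zero_of_green_eq_zero h.symm

lemma exists_isCompactOperator_SL_iff (hq : ∀ φ : L2, ¬ IsEigenpair q 0 φ) :
    ∃ K : L2 →L[ℂ] L2, IsCompactOperator K ∧ ∀ y g, SL q y g ↔ y = K g := by
  have hinj : ∀ y, y = green (-mulOp q y) → y = 0 := fun y hy => by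
    by_contra hy0
    refine hq y ⟨hy0, ?_⟩
    rwa [Complex.ofReal_zero, zero_smul, SL_iff_eq_green, zero_sub]
  obtain ⟨K, hK, hgreen⟩ :=
    exists_isCompactOperator_forall_eq_iff isCompactOperator_green (mulOp q) hinj
  exact ⟨K, hK, fun y g => SL_iff_eq_green.trans (hgreen y g)⟩

lemma exists_hilbertBasis_isEigenpair (hq : PositiveSpectrum q) :
    ∃ (ι : Type) (_ : Countable ι) (e : HilbertBasis ι ℂ L2) (lam : ι → ℝ) (δ : ℝ),
      0 < δ ∧ (∀ i, δ ≤ lam i) ∧ ∀ i, IsEigenpair q (lam i) (e i) := by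
  obtain ⟨K, hK, hSL⟩ :=
    exists_isCompactOperator_SL_iff fun φ hφ => lt_irrefl 0 (hq 0 φ hφ)
  have hSLK : ∀ g, SL q (K g) g := fun g => (hSL _ g).2 rfl
  have hsymm : (K : L2 →ₗ[ℂ] L2).IsSymmetric := fun f g => ((hSLK f).inner_eq (hSLK g)).symm
  obtain ⟨ι, e, m, he⟩ := exists_hilbertBasis_eigenvectors hK hsymm
  have : Fact ((2 : ℝ≥0∞) ≠ ∞) := ⟨ENNReal.ofNat_ne_top⟩
  have he0 : ∀ i, e i ≠ 0 := e.orthonormal.ne_zero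
  have hm : ∀ i, (m i : ℂ) ≠ 0 := fun i hmi =>
    he0 i (SL.eq_zero_of_zero (q := q) (by simpa [he, hmi] using hSLK (e i)))
  have hpair : ∀ i, IsEigenpair q (m i)⁻¹ (e i) := fun i => by
    refine ⟨he0 i, (hSL _ _).2 ?_⟩
    rw [map_smul, he, smul_smul, Complex.ofReal_inv]
    exact (inv_mul_cancel₀ (hm i)).symm ▸ (one_smul ℂ _).symm
  have hnorm : ∀ i, m i ≤ ‖K‖ + 1 := fun i =>
    calc m i ≤ ‖K (e i)‖ := by
          simpa [he, norm_smul, e.orthonormal.norm_eq_one, -Complex.coe_smul] using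
            le_abs_self (m i)
      _ ≤ ‖K‖ := by simpa [e.orthonormal.norm_eq_one] using K.le_opNorm (e i)
      _ ≤ ‖K‖ + 1 := by linarith
  exact ⟨ι, countable_of_orthonormal e.orthonormal, e, fun i => (m i)⁻¹, (‖K‖ + 1)⁻¹,
    by positivity, fun i => inv_anti₀ (inv_pos.1 (hq _ _ (hpair i))) (hnorm i), hpair⟩

lemma isPow_pow {r : ℝ} {f : L2} (hf : ∃ g, IsPow q r f g) : IsPow q r f (pow q r f) := by
  rw [pow, dif_pos hf]
  exact hf.choose_spec

lemma IsPow.sub {r : ℝ} {f g f' g' : L2} (h : IsPow q r f g) (h' : IsPow q r f' g') :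
    IsPow q r (f - f') (g - g') := fun l φ hφ => by
  rw [inner_sub_right, inner_sub_right, h l φ hφ, h' l φ hφ, mul_sub]

lemma MemW.sub {s : ℝ} {f f' : L2} (hf : MemW q s f) (hf' : MemW q s f') : MemW q s (f - f') :=
  ⟨_, (isPow_pow hf).sub (isPow_pow hf')⟩

section Eigenbasis

variable {ι : Type*} {e : HilbertBasis ι ℂ L2} {lam : ι → ℝ}

lemma IsPow.pow_eq (he : ∀ i, IsEigenpair q (lam i) (e i)) {r : ℝ} {f g : L2}
    (h : IsPow q r f g) : pow q r f = g := by
  refine e.repr.injective (lp.ext (funext fun i => ?_))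
  rw [e.repr_apply_apply, e.repr_apply_apply, isPow_pow ⟨g, h⟩ _ _ (he i), h _ _ (he i)]

lemma pow_sub (he : ∀ i, IsEigenpair q (lam i) (e i)) {r : ℝ} {f f' : L2}
    (hf : ∃ g, IsPow q r f g) (hf' : ∃ g, IsPow q r f' g) :
    pow q r (f - f') = pow q r f - pow q r f' :=
  ((isPow_pow hf).sub (isPow_pow hf')).pow_eq he

lemma MemW.norm_le_mul_normW (he : ∀ i, IsEigenpair q (lam i) (e i)) {δ s : ℝ} (hδ : 0 < δ)
    (hlam : ∀ i, δ ≤ lam i) (hs : 0 ≤ s) {f : L2} (hf : MemW q s f) :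
    ‖f‖ ≤ (δ ^ (s / 2))⁻¹ * normW q s f :=
  norm_le_inv_mul_norm_of_inner_eq (Real.rpow_pos_of_pos hδ _)
    (fun i => Real.rpow_le_rpow hδ.le (hlam i) (by positivity)) fun i => isPow_pow hf _ _ (he i)

end Eigenbasis

end Eigenfunctions

/-! ### Comparison of solutions -/

section Comparison

variable {q : Linf} {ι : Type*} {e : HilbertBasis ι ℂ L2} {lam : ι → ℝ} {s T : ℝ}
  {a a' b b' : Linf} {u₀ u₀' u₁ u₁' : L2} {u u' : ℝ → L2}

lemma IsSolution.apply_zero (h : IsSolution q s T a b u₀ u₁ u) : u 0 = u₀ := by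
  obtain ⟨-, -, v, -, -, hu₀, -⟩ := h
  exact hu₀

lemma IsSolution.exists_isDiagonalWave (h : IsSolution q s T a b u₀ u₁ u)
    (he : ∀ i, IsEigenpair q (lam i) (e i)) (hlam : ∀ i, 0 ≤ lam i) :
    ∃ v, v 0 = u₁ ∧ IsDiagonalWave e (fun i => lam i ^ (s / 2)) T
      (fun t => -(mulOp a (u t) + mulOp b (v t))) u v (fun t => pow q (s / 2) (u t)) := by
  obtain ⟨hW, -, v, hv, hvc, -, hv0, heq⟩ := h
  refine ⟨v, hv0, hv, hvc, fun t ht i => isPow_pow (hW t ht) _ _ (he i), fun t ht i => ?_⟩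
  have hsq : (lam i ^ (s / 2)) ^ 2 = lam i ^ s := by
    rw [← Real.rpow_mul_natCast (hlam i), Nat.cast_two, div_mul_cancel₀ _ two_ne_zero]
  refine (heq (e i) _ (he i).isTest ((he i).isPow s) t ht).congr_deriv ?_
  rw [inner_smul_left, Complex.conj_ofReal, ← mulOp_apply, ← mulOp_apply, ← hsq,
    Complex.ofReal_pow, inner_neg_right, sub_eq_add_neg]

lemma IsSolution.normW_sub_le [Countable ι] (h : IsSolution q s T a b u₀ u₁ u)
    (h' : IsSolution q s T a' b' u₀' u₁' u') (he : ∀ i, IsEigenpair q (lam i) (e i)) {δ : ℝ}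
    (hδ : 0 < δ) (hlam : ∀ i, δ ≤ lam i) (hs : 0 ≤ s) (ha : 0 ≤ a) (ha' : 0 ≤ a') (hb : 0 ≤ b)
    (hb' : 0 ≤ b') {M t : ℝ} (hM : M = 1 + (δ ^ (s / 2))⁻¹) (ht : t ∈ Icc 0 T) :
    normW q s (u t - u' t) ≤ Real.exp T * ((1 + ‖a'‖) * (‖u₁ - u₁'‖ + M * normW q s (u₀ - u₀') +
      (‖a - a'‖ + ‖b - b'‖) * (M * (Real.exp T * ((1 + ‖a‖) * (‖u₁‖ + M * normW q s u₀)))))) := by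
  have h0 : (0 : ℝ) ∈ Icc 0 T := ⟨le_rfl, ht.1.trans ht.2⟩
  have hlam0 : ∀ i, 0 ≤ lam i := fun i => hδ.le.trans (hlam i)
  have hδs : 0 < δ ^ (s / 2) := Real.rpow_pos_of_pos hδ _
  have hμ : ∀ i, δ ^ (s / 2) ≤ lam i ^ (s / 2) := fun i =>
    Real.rpow_le_rpow hδ.le (hlam i) (by positivity)
  have hpow : ∀ τ ∈ Icc 0 T,
      normW q s (u τ - u' τ) = ‖pow q (s / 2) (u τ) - pow q (s / 2) (u' τ)‖ := fun τ hτ => by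
    rw [normW, pow_sub he (h.1 τ hτ) (h'.1 τ hτ)]
  obtain ⟨v, hv0, hwave⟩ := h.exists_isDiagonalWave he hlam0
  obtain ⟨v', hv0', hwave'⟩ := h'.exists_isDiagonalWave he hlam0
  have hestimate := hwave.norm_sub_le hwave' hδs hμ (isPositive_mulOp ha) (isPositive_mulOp ha')
    (isPositive_mulOp hb).2 (isPositive_mulOp hb').2 ht
  rw [← hpow t ht, ← hpow 0 h0, h.apply_zero, h'.apply_zero, hv0, hv0', ← mulOp_sub, ← mulOp_sub,
    ← hM] at hestimate
  have hM0 : 0 ≤ M := by rw [hM]; positivity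
  refine hestimate.trans ?_
  have hW : ∀ f, 0 ≤ normW q s f := fun f => norm_nonneg _
  have := hW u₀
  have := hW (u₀ - u₀')
  change _ * (_ * (_ + _ + _ * (_ * (_ * (_ * (_ + _ * normW q s u₀)))))) ≤ _
  gcongr <;> exact norm_mulOp_le _

end Comparison

/-! ### Moderate and negligible nets -/

section Nets

variable {f g : ℝ → ℝ}

lemma isModerate_const {c : ℝ} (hc : 0 ≤ c) : IsModerate id (fun _ : ℝ => c) :=
  ⟨0, c + 1, by linarith, fun ε _ => by simp⟩

lemma IsModerate.mono {X Y : Type*} {nrm : X → ℝ} {nrm' : Y → ℝ} {f : ℝ → X} {g : ℝ → Y}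
    (hg : IsModerate nrm' g) (hfg : ∀ ε ∈ Ioc (0 : ℝ) 1, nrm (f ε) ≤ nrm' (g ε)) :
    IsModerate nrm f := by
  obtain ⟨N, C, hC, hbound⟩ := hg
  exact ⟨N, C, hC, fun ε hε => (hfg ε hε).trans (hbound ε hε)⟩

lemma IsNegligible.isModerate {X : Type*} {nrm : X → ℝ} {f : ℝ → X} (hf : IsNegligible nrm f) :
    IsModerate nrm f := by
  obtain ⟨C, hC, hbound⟩ := hf 1 one_pos
  refine ⟨0, C, hC, fun ε hε => (hbound ε hε).trans ?_⟩
  have hε1 := hε.2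
  rw [Real.rpow_one, Nat.cast_zero, neg_zero, Real.rpow_zero]
  gcongr

lemma IsModerate.add (hf : IsModerate id f) (hg : IsModerate id g) :
    IsModerate id (fun ε => f ε + g ε) := by
  obtain ⟨N, C, hC, hfb⟩ := hf
  obtain ⟨N', C', hC', hgb⟩ := hg
  refine ⟨max N N', C + C', by positivity, fun ε hε => ?_⟩
  have hmono : ∀ n ≤ max N N', ε ^ (-(n : ℝ)) ≤ ε ^ (-(max N N' : ℕ) : ℝ) := fun n hn =>
    Real.rpow_le_rpow_of_exponent_ge hε.1 hε.2 (neg_le_neg (Nat.cast_le.2 hn))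
  calc f ε + g ε ≤ C * ε ^ (-(N : ℝ)) + C' * ε ^ (-(N' : ℝ)) := add_le_add (hfb ε hε) (hgb ε hε)
    _ ≤ C * ε ^ (-(max N N' : ℕ) : ℝ) + C' * ε ^ (-(max N N' : ℕ) : ℝ) := by
        gcongr C * ?_ + C' * ?_
        exacts [hmono _ (le_max_left _ _), hmono _ (le_max_right _ _)]
    _ = (C + C') * ε ^ (-(max N N' : ℕ) : ℝ) := (add_mul _ _ _).symm

lemma IsModerate.mul (hf : IsModerate id f) (hg : IsModerate id g) (hg0 : ∀ ε, 0 ≤ g ε) :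
    IsModerate id (fun ε => f ε * g ε) := by
  obtain ⟨N, C, hC, hfb⟩ := hf
  obtain ⟨N', C', hC', hgb⟩ := hg
  refine ⟨N + N', C * C', by positivity, fun ε hε => ?_⟩
  have hε0 := hε.1
  calc f ε * g ε ≤ (C * ε ^ (-(N : ℝ))) * (C' * ε ^ (-(N' : ℝ))) :=
        mul_le_mul (hfb ε hε) (hgb ε hε) (hg0 ε) (by positivity)
    _ = C * C' * ε ^ (-((N + N' : ℕ) : ℝ)) := by
        rw [mul_mul_mul_comm, ← Real.rpow_add hε0, Nat.cast_add, neg_add]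

lemma IsNegligible.add (hf : IsNegligible id f) (hg : IsNegligible id g) :
    IsNegligible id (fun ε => f ε + g ε) := by
  intro k hk
  obtain ⟨C, hC, hfb⟩ := hf k hk
  obtain ⟨C', hC', hgb⟩ := hg k hk
  exact ⟨C + C', by positivity, fun ε hε =>
    (add_le_add (hfb ε hε) (hgb ε hε)).trans_eq (add_mul _ _ _).symm⟩

lemma IsModerate.mul_isNegligible (hf : IsModerate id f) (hg : IsNegligible id g)
    (hg0 : ∀ ε, 0 ≤ g ε) : IsNegligible id (fun ε => f ε * g ε) := by
  intro k hk
  obtain ⟨N, C, hC, hfb⟩ := hf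
  obtain ⟨C', hC', hgb⟩ := hg (N + k) (by positivity)
  refine ⟨C * C', by positivity, fun ε hε => ?_⟩
  have hε0 := hε.1
  calc f ε * g ε ≤ (C * ε ^ (-(N : ℝ))) * (C' * ε ^ ((N : ℝ) + k)) :=
        mul_le_mul (hfb ε hε) (hgb ε hε) (hg0 ε) (by positivity)
    _ = C * C' * ε ^ k := by rw [mul_mul_mul_comm, ← Real.rpow_add hε0, neg_add_cancel_left]

lemma IsModerate.of_isNegligible_sub {E : Type*} [SeminormedAddCommGroup E] {x x' : ℝ → E}
    (hx : IsModerate norm x) (hxx' : IsNegligible norm (fun ε => x ε - x' ε)) :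
    IsModerate norm x' :=
  (IsModerate.add (f := fun ε => ‖x ε‖) (g := fun ε => ‖x ε - x' ε‖) hx hxx'.isModerate).mono
    fun ε _ => norm_le_norm_add_norm_sub (x ε) (x' ε)

lemma isNegligible_stability_bound {E F : Type*} [SeminormedAddCommGroup E]
    [SeminormedAddCommGroup F] {κ M : ℝ} (hκ : 0 ≤ κ) (hM : 0 ≤ M) {a a' a₁ b₁ : ℝ → E}
    {v A v₁ A₁ : ℝ → F} (ha : IsModerate norm a) (ha' : IsModerate norm a')
    (hv : IsModerate norm v) (hA : IsModerate norm A) (ha₁ : IsNegligible norm a₁)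
    (hb₁ : IsNegligible norm b₁) (hv₁ : IsNegligible norm v₁) (hA₁ : IsNegligible norm A₁) :
    IsNegligible id (fun ε => κ * ((1 + ‖a' ε‖) * (‖v₁ ε‖ + M * ‖A₁ ε‖ +
      (‖a₁ ε‖ + ‖b₁ ε‖) * (M * (κ * ((1 + ‖a ε‖) * (‖v ε‖ + M * ‖A ε‖))))))) := by
  have hcoeff : ∀ {a : ℝ → E}, IsModerate norm a → IsModerate id fun ε => 1 + ‖a ε‖ :=
    fun ha => (isModerate_const zero_le_one).add ha
  have hdata : IsModerate id fun ε => ‖v ε‖ + M * ‖A ε‖ :=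
    IsModerate.add hv ((isModerate_const hM).mul hA fun ε => norm_nonneg _)
  have hsolution : IsModerate id fun ε => M * (κ * ((1 + ‖a ε‖) * (‖v ε‖ + M * ‖A ε‖))) :=
    (isModerate_const hM).mul ((isModerate_const hκ).mul
      ((hcoeff ha).mul hdata fun ε => by positivity) fun ε => by positivity)
      fun ε => by positivity
  have hforcing : IsNegligible id fun ε =>
      (‖a₁ ε‖ + ‖b₁ ε‖) * (M * (κ * ((1 + ‖a ε‖) * (‖v ε‖ + M * ‖A ε‖)))) := by
    simpa only [mul_comm] using
      hsolution.mul_isNegligible (IsNegligible.add ha₁ hb₁) fun ε => by positivity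
  have hdata₁ : IsNegligible id fun ε => ‖v₁ ε‖ + M * ‖A₁ ε‖ :=
    IsNegligible.add hv₁ ((isModerate_const hM).mul_isNegligible hA₁ fun ε => norm_nonneg _)
  exact (isModerate_const hκ).mul_isNegligible ((hcoeff ha').mul_isNegligible
    (hdata₁.add hforcing) fun ε => by positivity) fun ε => by positivity

end Nets

end FracSL

end

open FracSL in
theorem mainTheorem6_general {s T : ℝ} (hs : 0 ≤ s) {q : Linf} (hq : PositiveSpectrum q)
    {a a' b b' : ℝ → Linf} {u₀ u₀' u₁ u₁' : ℝ → L2} {u u' : ℝ → ℝ → L2}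
    (ha : ∀ ε ∈ Ioc (0 : ℝ) 1, 0 ≤ a ε) (ha' : ∀ ε ∈ Ioc (0 : ℝ) 1, 0 ≤ a' ε)
    (hb : ∀ ε ∈ Ioc (0 : ℝ) 1, 0 ≤ b ε) (hb' : ∀ ε ∈ Ioc (0 : ℝ) 1, 0 ≤ b' ε)
    (ham : IsModerate norm a) (haa' : IsNegligible norm (fun ε => a ε - a' ε))
    (hbb' : IsNegligible norm (fun ε => b ε - b' ε)) (hu₀ : IsModerate (normW q s) u₀)
    (hu₀u₀' : IsNegligible (normW q s) (fun ε => u₀ ε - u₀' ε)) (hu₁ : IsModerate norm u₁)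
    (hu₁u₁' : IsNegligible norm (fun ε => u₁ ε - u₁' ε))
    (hu : ∀ ε ∈ Ioc (0 : ℝ) 1, IsSolution q s T (a ε) (b ε) (u₀ ε) (u₁ ε) (u ε))
    (hu' : ∀ ε ∈ Ioc (0 : ℝ) 1, IsSolution q s T (a' ε) (b' ε) (u₀' ε) (u₁' ε) (u' ε))
    (k : ℝ) (hk : 0 < k) :
    ∃ C : ℝ, 0 < C ∧ ∀ ε ∈ Ioc (0 : ℝ) 1, ∀ t ∈ Icc (0 : ℝ) T,
      normW q s (u ε t - u' ε t) ≤ C * ε ^ k ∧ ‖u ε t - u' ε t‖ ≤ C * ε ^ k := by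
  obtain ⟨ι, _, e, lam, δ, hδ, hlam, he⟩ := exists_hilbertBasis_isEigenpair hq
  have hD : 0 ≤ (δ ^ (s / 2))⁻¹ := inv_nonneg.2 (Real.rpow_nonneg hδ.le _)
  have hM : 0 ≤ 1 + (δ ^ (s / 2))⁻¹ := by positivity
  obtain ⟨C, hC, hbound⟩ := (isModerate_const hM).mul_isNegligible
    (isNegligible_stability_bound (Real.exp_nonneg T) hM ham (ham.of_isNegligible_sub haa')
      hu₁ hu₀ haa' hbb' hu₁u₁' hu₀u₀') (fun ε => by positivity) k hk
  refine ⟨C, hC, fun ε hε t ht => ?_⟩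
  have hW := (hu ε hε).normW_sub_le (hu' ε hε) he hδ hlam hs (ha ε hε) (ha' ε hε) (hb ε hε)
    (hb' ε hε) rfl ht
  have hW0 : 0 ≤ normW q s (u ε t - u' ε t) := norm_nonneg _
  have hsum := (mul_le_mul_of_nonneg_left hW hM).trans (hbound ε hε)
  have hL2 := (((hu ε hε).1 t ht).sub ((hu' ε hε).1 t ht)).norm_le_mul_normW he hδ hlam hs
  constructor <;> nlinarith

theorem mainTheorem6 (s T : ℝ) (hs : 0 ≤ s) (hT : 0 < T) (q : FracSL.Linf)
    (hq : FracSL.PositiveSpectrum q) :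
    (∀ (a b : 𝓓'(FracSL.I01, ℝ)) (u₀ u₁ : 𝓓'(FracSL.I01, ℂ)),
      FracSL.HasUniqueVeryWeakSolution q s T a b u₀ u₁) ∧
    FracSL.NetUniqueness q s T Set.univ Set.univ Set.univ Set.univ := by
  have hunique : ∀ A B U V, FracSL.NetUniqueness q s T A B U V := by
    intro A B U V a a' _ _ ha ha' haa' b b' _ _ hb hb' hbb' u₀ u₀' _ _ hu₀ _ hu₀u₀'
      u₁ u₁' _ _ hu₁ _ hu₁u₁' u u' hu hu' k hk
    obtain ⟨C, hC, hbound⟩ := mainTheorem6_general hs hq ha.1 ha'.1 hb.1 hb'.1 ha.2 haa' hbb'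
      hu₀.2 hu₀u₀'.2 hu₁ hu₁u₁' hu hu' k hk
    exact ⟨C, hC, fun ε hε t ht => (hbound ε hε t ht).2⟩
  exact ⟨fun _ _ _ _ => hunique _ _ _ _, hunique _ _ _ _⟩
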